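/- Let $d\ge 4$ be an even integer, let $q$ be a prime power, let $V=\mathbb{F}_q^d$ be endowed with a non-degenerate symplectic form, and let $1\le k\le d/2$. Let $\Omega_k$ be the set of $k$-dimensional totally singular subspaces of $V$, that is, the $k$-dimensional subspaces on which the form vanishes identically. Let $\mathrm{P\Gamma Sp}_d(q)$ be the group of all semisimilarities of $V$ modulo scalars; it acts on $\Omega_k$. Let $G_0=\mathrm{PSp}_d(q)$ if $(d,q)\ne(4,2)$ and $G_0=\mathrm{PSp}_4(2)'$ (the derived subgroup) if $(d,q)=(4,2)$, and let $G$ be any group with $G_0\le G\le \mathrm{P\Gamma Sp}_d(q)$, acting on $\Omega_k$. A base for $G$ is a finite sequence $(\omega_1,\ldots,\omega_\ell)$ of elements of $\Omega_k$ with trivial pointwise stabilizer; it is irredundant if $G>G_{\omega_1}>G_{\omega_1,\omega_2}>\cdots>G_{\omega_1,\ldots,\omega_\ell}$. The base size $b(G)$ is the minimal length of a base, and the action of $G$ is IBIS if all irredundant bases have the same length. Then: 1. if $(q,k)\ne(2,1)$ and $(d,q,k)\ne(4,2,2)$, then the action of $G$ on $\Omega_k$ is not IBIS and $b(G)\ge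 2$; 2. if $(q,k)=(2,1)$ or $(d,q,k)=(4,2,2)$, then the action of $G$ on $\Omega_k$ is IBIS. -/

import Mathlib

section PermutationGroups

variable (G : Type*) [Group G] {Ω : Type*} [MulAction G Ω]

/-- The pointwise stabilizer in `G` of (the entries of) a finite sequence of points. -/
def pointwiseStabilizer (l : List Ω) : Subgroup G :=
  fixingSubgroup G {ω : Ω | ω ∈ l}

/-- A base: a finite sequence of points whose pointwise stabilizer is trivial. -/
def IsBase (l : List Ω) : Prop :=
  pointwiseStabilizer G l = ⊥

/-- An irredundant sequence `(ω₁, …, ω_ℓ)`: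
`G > G_{ω₁} > G_{ω₁,ω₂} > ⋯ > G_{ω₁,…,ω_ℓ}`. -/
def IsIrredundant (l : List Ω) : Prop :=
  ∀ i < l.length,
    pointwiseStabilizer G (l.take (i + 1)) < pointwiseStabilizer G (l.take i)

/-- An irredundant base. -/
def IsIrredundantBase (l : List Ω) : Prop :=
  IsBase G l ∧ IsIrredundant G l

variable (Ω)

/-- The action of `G` on `Ω` is IBIS: all irredundant bases have the same size. -/
def IsIBIS : Prop :=
  ∀ l l' : List Ω, IsIrredundantBase G l → IsIrredundantBase G l' → l.length = l'.length

/-- The base size `b(G)`: the minimal length of a base. -/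
noncomputable def baseSize : ℕ :=
  sInf {n : ℕ | ∃ l : List Ω, IsBase G l ∧ l.length = n}

end PermutationGroups

namespace Sympl

section Space

variable (F : Type*) [Field F] (m : ℕ)

/-- The space `V = F^{2m}` with coordinates with respect to the basis
`e₁, …, e_m, f₁, …, f_m`; the index `Sum.inl i` belongs to `e_i` and `Sum.inr i` to `f_i`. -/
abbrev Space : Type _ := Fin m ⊕ Fin m → F

variable {F m}

/-- The symplectic form on `V`, with `(e_i, e_j) = (f_i, f_j) = 0` and `(e_i, f_j) = δ_{ij}`. -/
def form (u v : Space F m) : F :=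
  ∑ i : Fin m, (u (Sum.inl i) * v (Sum.inr i) - u (Sum.inr i) * v (Sum.inl i))

/-- `g` is a semisimilarity of the symplectic space: it is additive, semilinear with respect to a
field automorphism `σ`, and `(g u, g v) = c σ((u, v))` for some nonzero constant `c`. -/
def IsSemisimilarity (g : Equiv.Perm (Space F m)) : Prop :=
  (∀ u v, g (u + v) = g u + g v) ∧
    ∃ (σ : F ≃+* F) (c : F), c ≠ 0 ∧ (∀ (a : F) v, g (a • v) = σ a • g v) ∧
      ∀ u v, form (g u) (g v) = c * σ (form u v)

theorem IsSemisimilarity.one : IsSemisimilarity (1 : Equiv.Perm (Space F m)) :=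
  ⟨fun _ _ => rfl, RingEquiv.refl F, 1, one_ne_zero, fun _ _ => rfl, fun _ _ => by simp⟩

theorem IsSemisimilarity.mul {g h : Equiv.Perm (Space F m)}
    (hg : IsSemisimilarity g) (hh : IsSemisimilarity h) : IsSemisimilarity (g * h) := by
  obtain ⟨ag, σ, c, hc, sg, fg⟩ := hg
  obtain ⟨ah, τ, e, he, sh, fh⟩ := hh
  refine ⟨fun u v => by simp [ah, ag], τ.trans σ, c * σ e,
    mul_ne_zero hc (by simpa using he), fun a v => by simp [sh, sg], fun u v => ?_⟩
  simp [fg, fh, mul_assoc]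

theorem IsSemisimilarity.inv {g : Equiv.Perm (Space F m)}
    (hg : IsSemisimilarity g) : IsSemisimilarity g⁻¹ := by
  obtain ⟨ag, σ, c, hc, sg, fg⟩ := hg
  refine ⟨fun u v => ?_, σ.symm, σ.symm c⁻¹, by simpa using hc, fun a v => ?_, fun u v => ?_⟩
  · apply g.injective
    simp [ag]
  · apply g.injective
    simp [sg]
  · apply σ.injective
    have h := fg (g⁻¹ u) (g⁻¹ v)
    simp only [Equiv.Perm.inv_def, Equiv.apply_symm_apply] at h
    simp [h, hc]

variable (F m)

/-- `ΓSp_{2m}(F)`, the group of all semisimilarities of the symplectic space. -/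
def GammaSp : Subgroup (Equiv.Perm (Space F m)) where
  carrier := {g | IsSemisimilarity g}
  one_mem' := IsSemisimilarity.one
  mul_mem' := IsSemisimilarity.mul
  inv_mem' := IsSemisimilarity.inv

/-- The subgroup of nonzero scalars. -/
def scalars : Subgroup (GammaSp F m) where
  carrier := {g | ∃ a : F, a ≠ 0 ∧ ∀ v, g.1 v = a • v}
  one_mem' := ⟨1, one_ne_zero, fun v => by simp⟩
  mul_mem' := by
    rintro g h ⟨a, ha, hg⟩ ⟨b, hb, hh⟩
    exact ⟨a * b, mul_ne_zero ha hb, fun v => by simp [hg, hh, mul_smul]⟩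
  inv_mem' := by
    rintro g ⟨a, ha, hg⟩
    refine ⟨a⁻¹, inv_ne_zero ha, fun v => ?_⟩
    apply g.1.injective
    rw [hg (a⁻¹ • v), smul_smul, mul_inv_cancel₀ ha, one_smul]
    exact g.1.apply_symm_apply v

instance scalars_normal : (scalars F m).Normal where
  conj_mem := by
    rintro g ⟨a, ha, hg⟩ h
    obtain ⟨-, σ, c, -, sh, -⟩ := h.2
    refine ⟨σ a, by simpa using ha, fun v => ?_⟩
    simp [hg, sh]

/-- `Sp_{2m}(F)`, the group of linear isometries, as a subgroup of `ΓSp_{2m}(F)`. -/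
def Sp : Subgroup (GammaSp F m) where
  carrier := {g | (∀ (a : F) v, g.1 (a • v) = a • g.1 v) ∧
    ∀ u v, form (g.1 u) (g.1 v) = form u v}
  one_mem' := ⟨fun _ _ => rfl, fun _ _ => rfl⟩
  mul_mem' := by
    rintro g h ⟨sg, fg⟩ ⟨sh, fh⟩
    exact ⟨fun a v => by simp [sg, sh], fun u v => by simp [fg, fh]⟩
  inv_mem' := by
    rintro g ⟨sg, fg⟩
    refine ⟨fun a v => ?_, fun u v => ?_⟩
    · apply g.1.injective
      simp [sg]
    · have h := fg (g.1⁻¹ u) (g.1⁻¹ v)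
      simp only [Equiv.Perm.inv_def, Equiv.apply_symm_apply] at h
      exact h.symm

/-- `PΓSp_{2m}(F) = ΓSp_{2m}(F) / {scalars}`. -/
abbrev PGammaSp : Type _ := GammaSp F m ⧸ scalars F m

/-- `PSp_{2m}(F)`, the image of `Sp_{2m}(F)` in `PΓSp_{2m}(F)`. -/
def PSp : Subgroup (PGammaSp F m) :=
  (Sp F m).map (QuotientGroup.mk' (scalars F m))

/-- The simple group `G₀`: it is `PSp_{2m}(F)`, except that for `2m = 4` and `|F| = 2`, where
`PSp_4(2)` is not simple, it is the derived subgroup `PSp_4(2)'`. -/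
noncomputable def simpleGroup : Subgroup (PGammaSp F m) :=
  if m = 2 ∧ Nat.card F = 2 then ⁅PSp F m, PSp F m⁆ else PSp F m

/-- `Ω_k`: the set of `k`-dimensional totally singular subspaces of `V`. -/
def TotallySingular (k : ℕ) : Type _ :=
  {W : Submodule F (Space F m) // Module.finrank F W = k ∧ ∀ u ∈ W, ∀ v ∈ W, form u v = 0}

variable {F m}

/-- The image of a subspace under a semisimilarity. -/
def imageSubspace (g : GammaSp F m) (W : Submodule F (Space F m)) :
    Submodule F (Space F m) where
  carrier := g.1 '' W
  zero_mem' := ⟨0, W.zero_mem, by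
    have h := g.2.1 0 0
    simpa using h⟩
  add_mem' := by
    rintro _ _ ⟨u, hu, rfl⟩ ⟨v, hv, rfl⟩
    exact ⟨u + v, W.add_mem hu hv, g.2.1 u v⟩
  smul_mem' := by
    rintro a _ ⟨u, hu, rfl⟩
    obtain ⟨-, σ, c, -, sg, -⟩ := g.2
    exact ⟨σ.symm a • u, W.smul_mem _ hu, by simp [sg]⟩

theorem finrank_imageSubspace (g : GammaSp F m) (W : Submodule F (Space F m)) :
    Module.finrank F (imageSubspace g W) = Module.finrank F W := by
  obtain ⟨ag, σ, c, -, sg, -⟩ := g.2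
  let e : W ≃+ imageSubspace g W :=
    { Equiv.Set.image g.1 (W : Set (Space F m)) g.1.injective with
      map_add' := fun u v => Subtype.ext (ag u v) }
  have h := rank_eq_of_equiv_equiv (σ : F → F) e σ.bijective
    (fun a v => Subtype.ext (sg a v))
  exact (congrArg Cardinal.toNat h).symm

/-- The natural action of `ΓSp_{2m}(F)` on `Ω_k`. -/
instance (k : ℕ) : MulAction (GammaSp F m) (TotallySingular F m k) where
  smul g W := ⟨imageSubspace g W.1, (finrank_imageSubspace g W.1).trans W.2.1, by
    rintro _ ⟨u, hu, rfl⟩ _ ⟨v, hv, rfl⟩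
    obtain ⟨-, σ, c, -, -, fg⟩ := g.2
    rw [fg, W.2.2 u hu v hv, map_zero, mul_zero]⟩
  one_smul W := Subtype.ext (SetLike.coe_injective (Set.image_id _))
  mul_smul g h W := Subtype.ext (SetLike.coe_injective (Set.image_comp g.1 h.1 _))

theorem scalars_smul (k : ℕ) (g : GammaSp F m) (hg : g ∈ scalars F m)
    (W : TotallySingular F m k) : g • W = W := by
  obtain ⟨a, ha, h⟩ := hg
  apply Subtype.ext
  ext v
  constructor
  · rintro ⟨u, hu, rfl⟩
    rw [h]
    exact W.1.smul_mem a hu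
  · intro hv
    exact ⟨a⁻¹ • v, W.1.smul_mem _ hv, by rw [h, smul_smul, mul_inv_cancel₀ ha, one_smul]⟩

/-- The permutation representation of `PΓSp_{2m}(F)` on `Ω_k`. -/
def permRep (k : ℕ) : PGammaSp F m →* Equiv.Perm (TotallySingular F m k) :=
  QuotientGroup.lift (scalars F m)
    (MulAction.toPermHom (GammaSp F m) (TotallySingular F m k))
    (fun g hg => Equiv.ext (scalars_smul k g hg))

/-- The natural action of `PΓSp_{2m}(F)` on `Ω_k`, induced by that of `ΓSp_{2m}(F)`. -/
instance (k : ℕ) : MulAction (PGammaSp F m) (TotallySingular F m k) :=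
  MulAction.compHom _ (permRep k)

end Space

end Sympl

/-! ### Irredundant sequences and a criterion for failing IBIS -/

section PermutationGroups

variable {G : Type*} [Group G] {Ω : Type*} [MulAction G Ω]

/-! An action is not IBIS once there are a set `S` of points and points `ω`, `ω'` such that adding
`ω` to `S` makes the stabilizer trivial, while adding `ω'` makes it smaller but not trivial: an
irredundant sequence with the stabilizer of `S` is completed to a base by one point, or, through
`ω'`, by at least two (`not_isIBIS_of_set`). Moreover `b(G) ≥ 2`, because the transvection along a
nonzero vector of a totally singular `W` fixes `W`.

The points are chosen so that the stabilizer of `S` is explicit. If `q ≥ 4`, or `q = 3` and `d ≥ 6`,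
take for `S` all coordinate subspaces; its stabilizer is diagonal up to a field automorphism. A
graph in general position leaves only scalars, while a second subspace cuts out the condition `a_0
a_1 = 1` on the torus (`not_isIBIS_of_torus`). Over `𝔽₂` the torus is trivial and unipotent
stabilizers replace it. For `q = 3`, `d = 4` the condition `a_0 a_1 = 1` leaves only scalars of the
torus, and stabilizers mixing torus and unipotent elements are used.

In the exceptional cases let first `q = 2`, `k = 1`. Points are nonzero vectors, and a group element
fixing some vectors fixes their span, so the vectors of an irredundant sequence are independent.
Quotients of two transvections are commutators, so `G` contains all transvections or none. A
nontrivial isometry fixing a hyperplane pointwise is a transvection; hence irredundant bases have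
length `2m` in the first case and `2m - 1` in the second (`isIBIS_of_card_eq_two`). For `(d, q, k) =
(4, 2, 2)`, Plücker coordinates identify totally singular lines with nonzero vectors so that meeting
becomes orthogonality. This duality induces an automorphism of the group (`duality`) and reduces
lines to points. -/

theorem mem_pointwiseStabilizer {l : List Ω} {g : G} :
    g ∈ pointwiseStabilizer G l ↔ ∀ ω ∈ l, g • ω = ω := by
  simp [pointwiseStabilizer, mem_fixingSubgroup_iff]

theorem pointwiseStabilizer_append_singleton (l : List Ω) (ω : Ω) :
    pointwiseStabilizer G (l ++ [ω]) = pointwiseStabilizer G l ⊓ MulAction.stabilizer G ω := by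
  ext g
  simp only [mem_pointwiseStabilizer, Subgroup.mem_inf, MulAction.mem_stabilizer_iff,
    List.mem_append, List.mem_singleton]
  exact ⟨fun h => ⟨fun x hx => h x (Or.inl hx), h ω (Or.inr rfl)⟩,
    fun h x hx => hx.elim (h.1 x) (fun e => e ▸ h.2)⟩

theorem pointwiseStabilizer_append_congr {l l' : List Ω}
    (h : pointwiseStabilizer G l = pointwiseStabilizer G l') (t : List Ω) :
    pointwiseStabilizer G (l ++ t) = pointwiseStabilizer G (l' ++ t) := by
  ext g
  have := SetLike.ext_iff.1 h g
  simp only [mem_pointwiseStabilizer, List.forall_mem_append] at this ⊢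
  rw [this]

theorem pointwiseStabilizer_append_le (l t : List Ω) :
    pointwiseStabilizer G (l ++ t) ≤ pointwiseStabilizer G l := fun g hg => by
  rw [mem_pointwiseStabilizer] at hg ⊢
  exact fun ω h => hg ω (List.mem_append_left _ h)

theorem isIrredundant_nil : IsIrredundant G ([] : List Ω) := by
  intro i hi
  simp at hi

theorem isIrredundant_append_singleton {l : List Ω} {ω : Ω} :
    IsIrredundant G (l ++ [ω]) ↔
      IsIrredundant G l ∧ pointwiseStabilizer G (l ++ [ω]) < pointwiseStabilizer G l := by
  have take_eq : ∀ i ≤ l.length, (l ++ [ω]).take i = l.take i := fun i hi =>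
    List.take_append_of_le_length hi
  constructor
  · intro h
    refine ⟨fun i hi => ?_, ?_⟩
    · have := h i (by simp; omega)
      rwa [take_eq _ hi, take_eq _ hi.le] at this
    · have := h l.length (by simp)
      rwa [take_eq _ le_rfl, List.take_length, List.take_of_length_le (by simp)] at this
  · rintro ⟨h, h'⟩ i hi
    simp only [List.length_append, List.length_singleton] at hi
    rcases Nat.lt_succ_iff_lt_or_eq.1 hi with hi | rfl
    · rw [take_eq _ hi, take_eq _ hi.le]
      exact h i hi
    · rwa [take_eq _ le_rfl, List.take_length, List.take_of_length_le (by simp)]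

/-- An irredundant sequence extends to an irredundant one whose stabilizer is that of any
prescribed extension. -/
theorem IsIrredundant.exists_append {l : List Ω} (hl : IsIrredundant G l) (t : List Ω) :
    ∃ s : List Ω, IsIrredundant G (l ++ s) ∧
      pointwiseStabilizer G (l ++ s) = pointwiseStabilizer G (l ++ t) := by
  induction t using List.reverseRecOn with
  | nil => exact ⟨[], by simpa using hl, rfl⟩
  | append_singleton t ω ih =>
    obtain ⟨s, hs, hst⟩ := ih
    have key := pointwiseStabilizer_append_congr hst [ω]
    rw [List.append_assoc, List.append_assoc] at key
    by_cases h : pointwiseStabilizer G (l ++ s ++ [ω]) = pointwiseStabilizer G (l ++ s)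
    · exact ⟨s, hs, by rw [← key, ← List.append_assoc, h]⟩
    · refine ⟨s ++ [ω], ?_, key⟩
      rw [← List.append_assoc]
      exact isIrredundant_append_singleton.2
        ⟨hs, lt_of_le_of_ne (pointwiseStabilizer_append_le _ _) h⟩

/-- Replace `l` by an irredundant `s` with the same stabilizer. Then `s ++ [ω]` is an irredundant
base, whereas `s ++ [ω']` is irredundant and not yet a base, so completing it to an irredundant base
costs at least one more point. -/
theorem not_isIBIS_of_list (l : List Ω) (ω ω' : Ω)
    (h : pointwiseStabilizer G (l ++ [ω]) = ⊥)
    (h₁ : pointwiseStabilizer G (l ++ [ω']) ≠ ⊥)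
    (h₂ : pointwiseStabilizer G (l ++ [ω']) ≠ pointwiseStabilizer G l) : ¬ IsIBIS G Ω := by
  intro H
  obtain ⟨s, hs, hsl⟩ := (isIrredundant_nil (G := G) (Ω := Ω)).exists_append l
  simp only [List.nil_append] at hs hsl
  have e := pointwiseStabilizer_append_congr hsl [ω]
  have e' := pointwiseStabilizer_append_congr hsl [ω']
  have hne : pointwiseStabilizer G l ≠ ⊥ := fun h0 =>
    h₁ (le_bot_iff.1 (h0 ▸ pointwiseStabilizer_append_le l [ω']))
  have b : IsIrredundantBase G (s ++ [ω]) := by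
    refine ⟨e.trans h, isIrredundant_append_singleton.2 ⟨hs, ?_⟩⟩
    rw [e, h, hsl]
    exact bot_lt_iff_ne_bot.2 hne
  have c : IsIrredundant G (s ++ [ω']) := by
    refine isIrredundant_append_singleton.2
      ⟨hs, lt_of_le_of_ne (pointwiseStabilizer_append_le _ _) ?_⟩
    rwa [e', hsl]
  obtain ⟨t, ht, hts⟩ := c.exists_append [ω]
  have tb : pointwiseStabilizer G (s ++ [ω'] ++ t) = ⊥ := by
    rw [hts, eq_bot_iff, ← h, ← e]
    intro g hg
    rw [mem_pointwiseStabilizer] at hg ⊢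
    intro x hx
    apply hg
    simp only [List.mem_append, List.mem_singleton] at hx ⊢
    tauto
  -- Equal lengths force `t` to be empty, so `s ++ [ω']` would already be a base.
  have hlen := H _ _ b ⟨tb, ht⟩
  simp only [List.length_append, List.length_singleton] at hlen
  have : t = [] := List.length_eq_zero_iff.1 (by omega)
  rw [this, List.append_nil, e'] at tb
  exact h₁ tb

theorem not_isIBIS_of_set [Finite Ω] (S : Set Ω) (ω ω' : Ω)
    (h : ∀ g : G, (∀ x ∈ S, g • x = x) → g • ω = ω → g = 1)
    (h₁ : ∃ g : G, (∀ x ∈ S, g • x = x) ∧ g • ω' = ω' ∧ g ≠ 1)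
    (h₂ : ∃ g : G, (∀ x ∈ S, g • x = x) ∧ g • ω' ≠ ω') :
    ¬ IsIBIS G Ω ∧ ∃ l : List Ω, IsBase G l := by
  obtain ⟨l, hl⟩ : ∃ l : List Ω, ∀ x, x ∈ l ↔ x ∈ S :=
    ⟨(Set.toFinite S).toFinset.toList, fun x => by simp⟩
  have hb : pointwiseStabilizer G (l ++ [ω]) = ⊥ := by
    rw [eq_bot_iff]
    intro g hg
    rw [mem_pointwiseStabilizer] at hg
    exact h g (fun x hx => hg x (by simp [hl, hx])) (hg ω (by simp))
  refine ⟨not_isIBIS_of_list l ω ω' hb ?_ ?_, _, hb⟩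
  · obtain ⟨g, hg, hg', hg1⟩ := h₁
    intro hbot
    have : g ∈ pointwiseStabilizer G (l ++ [ω']) := by
      rw [mem_pointwiseStabilizer]
      intro x hx
      simp only [List.mem_append, List.mem_singleton, hl] at hx
      rcases hx with hx | rfl
      exacts [hg x hx, hg']
    rw [hbot] at this
    exact hg1 this
  · obtain ⟨g, hg, hg'⟩ := h₂
    intro heq
    have : g ∈ pointwiseStabilizer G l :=
      mem_pointwiseStabilizer.2 fun x hx => hg x ((hl x).1 hx)
    rw [← heq] at this
    exact hg' (mem_pointwiseStabilizer.1 this ω' (by simp))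

theorem two_le_baseSize (hb : ∃ l : List Ω, IsBase G l)
    (hω : ∀ ω : Ω, ∃ g : G, g • ω = ω ∧ g ≠ 1) [Nonempty Ω] : 2 ≤ baseSize G Ω := by
  -- Existence of a base matters here: the infimum of the empty set of naturals is `0`.
  apply le_csInf
  · obtain ⟨l, hl⟩ := hb
    exact ⟨_, l, hl, rfl⟩
  · rintro n ⟨l, hl, rfl⟩
    by_contra hlt
    obtain ⟨ω, hω'⟩ : ∃ ω : Ω, ∀ x ∈ l, x = ω := by
      match l, hlt with
      | [], _ => exact ⟨Classical.arbitrary Ω, by simp⟩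
      | [ω], _ => exact ⟨ω, by simp⟩
      | _ :: _ :: _, h => simp at h
    obtain ⟨g, hg, hg1⟩ := hω ω
    have : g ∈ pointwiseStabilizer G l :=
      mem_pointwiseStabilizer.2 fun x hx => hω' x hx ▸ hg
    rw [hl] at this
    exact hg1 this

end PermutationGroups

/-! ### The symplectic form, explicit isometries and coordinate subspaces -/

namespace Sympl

section Basics

variable {F : Type*} [Field F] {m : ℕ}

theorem form_add_left (u u' v : Space F m) : form (u + u') v = form u v + form u' v := by
  simp only [form, Pi.add_apply, ← Finset.sum_add_distrib]
  exact Finset.sum_congr rfl fun i _ => by ring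

theorem form_smul_left (a : F) (u v : Space F m) : form (a • u) v = a * form u v := by
  simp only [form, Pi.smul_apply, smul_eq_mul, Finset.mul_sum]
  exact Finset.sum_congr rfl fun i _ => by ring

theorem form_swap (u v : Space F m) : form v u = -form u v := by
  simp only [form, ← Finset.sum_neg_distrib]
  exact Finset.sum_congr rfl fun i _ => by ring

theorem form_add_right (u v v' : Space F m) : form u (v + v') = form u v + form u v' := by
  rw [form_swap, form_add_left, form_swap u v, form_swap u v']
  ring

theorem form_smul_right (a : F) (u v : Space F m) : form u (a • v) = a * form u v := by
  rw [form_swap, form_smul_left, form_swap u v]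
  ring

theorem form_self (u : Space F m) : form u u = 0 :=
  Finset.sum_eq_zero fun i _ => by ring

theorem form_single_inl_right (u : Space F m) (i : Fin m) :
    form u (Pi.single (Sum.inl i) 1) = -u (Sum.inr i) := by
  simp [form, Pi.single_apply]

theorem form_single_inr_right (u : Space F m) (i : Fin m) :
    form u (Pi.single (Sum.inr i) 1) = u (Sum.inl i) := by
  simp [form, Pi.single_apply]

theorem form_single_inl_left (u : Space F m) (i : Fin m) :
    form (Pi.single (Sum.inl i) 1) u = u (Sum.inr i) := by
  rw [form_swap, form_single_inl_right, neg_neg]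

theorem form_single_inr_left (u : Space F m) (i : Fin m) :
    form (Pi.single (Sum.inr i) 1) u = -u (Sum.inl i) := by
  rw [form_swap, form_single_inr_right]

theorem eq_zero_of_form_eq_zero {u : Space F m} (h : ∀ v, form u v = 0) : u = 0 := by
  funext x
  rcases x with i | i
  · simpa [form_single_inr_right] using h (Pi.single (Sum.inr i) 1)
  · simpa [form_single_inl_right] using h (Pi.single (Sum.inl i) 1)

variable (F m) in
/-- The symplectic form as a bilinear form. -/
def bilinForm : LinearMap.BilinForm F (Space F m) :=
  LinearMap.mk₂ F form form_add_left form_smul_left form_add_right form_smul_right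

@[simp]
theorem bilinForm_apply (u v : Space F m) : bilinForm F m u v = form u v := rfl

theorem bilinForm_nondegenerate : (bilinForm F m).Nondegenerate := by
  refine ⟨fun u h => eq_zero_of_form_eq_zero h, fun u h => eq_zero_of_form_eq_zero fun v => ?_⟩
  rw [form_swap, show form v u = 0 from h v, neg_zero]

/-! ### Isometries -/

/-- The isometry `u ↦ u + (u, v) w + (u, w) v + a (u, v) v` attached to orthogonal vectors
`v`, `w`; a transvection if `w = 0`. -/
def rootElement (v w : Space F m) (h : form v w = 0) (a : F) : GammaSp F m :=
  ⟨{ toFun := fun u => u + form u v • w + form u w • v + (a * form u v) • v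
     invFun := fun u => u - form u v • w - form u w • v - (a * form u v) • v
     left_inv := fun u => by
      have h' : form w v = 0 := by rw [form_swap, h, neg_zero]
      simp only [form_add_left, form_smul_left, h, h', form_self]
      funext x
      simp
      ring
     right_inv := fun u => by
      have h' : form w v = 0 := by rw [form_swap, h, neg_zero]
      simp only [sub_eq_add_neg, ← neg_smul, form_add_left, form_smul_left, h, h', form_self]
      funext x
      simp
      ring },
    fun u u' => by
      simp only [Equiv.coe_fn_mk, form_add_left]
      module,
    RingEquiv.refl F, 1, one_ne_zero, fun b u => by
      simp only [Equiv.coe_fn_mk, form_smul_left, RingEquiv.refl_apply]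
      module,
    fun u u' => by
      have h' : form w v = 0 := by rw [form_swap, h, neg_zero]
      simp only [Equiv.coe_fn_mk, form_add_left, form_smul_left, form_add_right, form_smul_right,
        h, h', form_self, form_swap u' v, form_swap u' w, RingEquiv.refl_apply]
      ring⟩

@[simp]
theorem rootElement_apply (v w : Space F m) (h : form v w = 0) (a : F) (u : Space F m) :
    (rootElement v w h a).1 u = u + form u v • w + form u w • v + (a * form u v) • v := rfl

theorem rootElement_mem_Sp (v w : Space F m) (h : form v w = 0) (a : F) :
    rootElement v w h a ∈ Sp F m := by
  refine ⟨fun b u => ?_, fun u u' => ?_⟩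
  · simp only [rootElement_apply, form_smul_left]
    module
  · have h' : form w v = 0 := by rw [form_swap, h, neg_zero]
    simp only [rootElement_apply, form_add_left, form_smul_left, form_add_right, form_smul_right,
      h, h', form_self, form_swap u' v, form_swap u' w]
    ring

theorem form_zero_right (v : Space F m) : form v 0 = 0 := by
  simp [form]

/-- The transvection `u ↦ u + (u, v) v`. -/
def transvection (v : Space F m) : GammaSp F m := rootElement v 0 (form_zero_right v) 1

@[simp]
theorem transvection_apply (v u : Space F m) : (transvection v).1 u = u + form u v • v := by
  simp [transvection, form_zero_right]

theorem transvection_notMem_scalars {v : Space F m} (hv : v ≠ 0) :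
    transvection v ∉ scalars F m := by
  rintro ⟨a, ha, hs⟩
  have h1 : a = 1 := by
    have := hs v
    rw [transvection_apply, form_self, zero_smul, add_zero] at this
    have h2 : (a - 1) • v = 0 := by rw [sub_smul, one_smul, ← this, sub_self]
    simpa [hv, sub_eq_zero] using h2
  subst h1
  refine hv (eq_zero_of_form_eq_zero fun u => ?_)
  have := hs u
  rw [transvection_apply, one_smul, add_eq_left, smul_eq_zero, or_iff_left hv] at this
  rw [form_swap, this, neg_zero]

/-- The diagonal isometry `e_i ↦ a_i e_i`, `f_i ↦ a_i⁻¹ f_i`. -/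
def torusElement (a : Fin m → Fˣ) : GammaSp F m :=
  ⟨{ toFun := fun u => Sum.elim (fun i => a i * u (Sum.inl i))
        (fun i => ((a i)⁻¹ : Fˣ) * u (Sum.inr i))
     invFun := fun u => Sum.elim (fun i => ((a i)⁻¹ : Fˣ) * u (Sum.inl i))
        (fun i => a i * u (Sum.inr i))
     left_inv := fun u => by
      funext x
      rcases x with i | i <;> simp
     right_inv := fun u => by
      funext x
      rcases x with i | i <;> simp },
    fun u u' => by
      funext x
      rcases x with i | i <;> simp [mul_add],
    RingEquiv.refl F, 1, one_ne_zero, fun b u => by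
      funext x
      rcases x with i | i <;> simp [mul_left_comm],
    fun u u' => by
      simp only [form, Equiv.coe_fn_mk, Sum.elim_inl, Sum.elim_inr, RingEquiv.refl_apply, one_mul]
      refine Finset.sum_congr rfl fun i _ => ?_
      have := (a i).mul_inv
      linear_combination (u (Sum.inl i) * u' (Sum.inr i) - u (Sum.inr i) * u' (Sum.inl i)) * this⟩

@[simp]
theorem torusElement_inl (a : Fin m → Fˣ) (u : Space F m) (i : Fin m) :
    (torusElement a).1 u (Sum.inl i) = a i * u (Sum.inl i) := rfl

@[simp]
theorem torusElement_inr (a : Fin m → Fˣ) (u : Space F m) (i : Fin m) :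
    (torusElement a).1 u (Sum.inr i) = ((a i)⁻¹ : Fˣ) * u (Sum.inr i) := rfl

theorem torusElement_mem_Sp (a : Fin m → Fˣ) : torusElement a ∈ Sp F m := by
  refine ⟨fun b u => ?_, fun u u' => ?_⟩
  · funext x
    rcases x with i | i <;> simp [mul_left_comm]
  · simp only [form, torusElement_inl, torusElement_inr]
    refine Finset.sum_congr rfl fun i _ => ?_
    have := (a i).mul_inv
    linear_combination (u (Sum.inl i) * u' (Sum.inr i) - u (Sum.inr i) * u' (Sum.inl i)) * this

/-! ### Semisimilarities in coordinates -/

theorem map_zero' (γ : GammaSp F m) : γ.1 0 = 0 := by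
  have h := γ.2.1 0 0
  simpa using h

theorem map_eq_sum (γ : GammaSp F m) {σ : F ≃+* F}
    (hσ : ∀ (a : F) v, γ.1 (a • v) = σ a • γ.1 v) (v : Space F m) :
    γ.1 v = ∑ x, σ (v x) • γ.1 (Pi.single x 1) := by
  let f : Space F m →+ Space F m := ⟨⟨γ.1, map_zero' γ⟩, γ.2.1⟩
  conv_lhs => rw [pi_eq_sum_univ' v]
  change f _ = _
  rw [map_sum]
  refine Finset.sum_congr rfl fun x _ => ?_
  change γ.1 _ = _
  rw [hσ]

theorem mem_scalars_of_single (γ : GammaSp F m) {σ : F ≃+* F}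
    (hσ : ∀ (a : F) v, γ.1 (a • v) = σ a • γ.1 v) (h1 : ∀ a, σ a = a) {s : F} (hs : s ≠ 0)
    (h : ∀ x, γ.1 (Pi.single x 1) = s • Pi.single x 1) : γ ∈ scalars F m := by
  refine ⟨s, hs, fun v => ?_⟩
  rw [map_eq_sum γ hσ v]
  funext y
  simp [h, h1, Pi.single_apply, mul_comm]

variable {k : ℕ}

instance [Finite F] : Finite (GammaSp F m) := Subtype.finite

instance [Finite F] : Finite (TotallySingular F m k) := Subtype.finite

theorem smul_val (γ : GammaSp F m) (W : TotallySingular F m k) :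
    (γ • W).1 = imageSubspace γ W.1 := rfl

theorem smul_eq_iff {γ : GammaSp F m} {W : TotallySingular F m k} :
    γ • W = W ↔ ∀ v ∈ W.1, γ.1 v ∈ W.1 := by
  constructor
  · intro h v hv
    have : γ.1 v ∈ (γ • W).1 := ⟨v, hv, rfl⟩
    rwa [h] at this
  · intro h
    apply Subtype.ext
    rw [smul_val]
    apply Submodule.eq_of_le_of_finrank_eq
    · rintro _ ⟨u, hu, rfl⟩
      exact h u hu
    · exact finrank_imageSubspace _ _

/-- The dimension of a subspace which projects isomorphically to a set of coordinates. -/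
theorem finrank_eq_card_of_coordinates (W : Submodule F (Space F m))
    (J : Finset (Fin m ⊕ Fin m)) (inj : ∀ v ∈ W, (∀ x ∈ J, v x = 0) → v = 0)
    (surj : ∀ c : Space F m, ∃ v ∈ W, ∀ x ∈ J, v x = c x) : Module.finrank F W = J.card := by
  let f : W →ₗ[F] (J → F) := (LinearMap.funLeft F F (Subtype.val : J → _)).comp W.subtype
  have hf : Function.Bijective f := by
    constructor
    · rw [← LinearMap.ker_eq_bot, LinearMap.ker_eq_bot']
      intro v hv
      exact Subtype.ext (inj v.1 v.2 fun x hx => congrFun hv ⟨x, hx⟩)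
    · intro c
      obtain ⟨v, hv, h⟩ := surj (fun x => if hx : x ∈ J then c ⟨x, hx⟩ else 0)
      refine ⟨⟨v, hv⟩, funext fun x => ?_⟩
      have := h x.1 x.2
      simpa [f, LinearMap.funLeft] using this
  rw [(LinearEquiv.ofBijective f hf).finrank_eq, Module.finrank_fintype_fun_eq_card,
    Fintype.card_coe]

variable (F) in
/-- The subspace spanned by the basis vectors indexed by `J`. -/
def coordSubspace (J : Finset (Fin m ⊕ Fin m)) : Submodule F (Space F m) where
  carrier := {v | ∀ x, x ∉ J → v x = 0}
  zero_mem' _ _ := rfl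
  add_mem' hu hv x hx := by simp [hu x hx, hv x hx]
  smul_mem' a v hv x hx := by simp [hv x hx]

theorem mem_coordSubspace {J : Finset (Fin m ⊕ Fin m)} {v : Space F m} :
    v ∈ coordSubspace F J ↔ ∀ x, x ∉ J → v x = 0 := Iff.rfl

theorem single_mem_coordSubspace {J : Finset (Fin m ⊕ Fin m)} {x : Fin m ⊕ Fin m} (hx : x ∈ J) :
    (Pi.single x 1 : Space F m) ∈ coordSubspace F J := fun y hy => by
  rw [Pi.single_apply, if_neg]
  rintro rfl
  exact hy hx

/-- A set of basis vectors without hyperbolic pairs. -/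
def IsotropicSet (J : Finset (Fin m ⊕ Fin m)) : Prop :=
  ∀ i, Sum.inl i ∈ J → Sum.inr i ∉ J

variable (F) in
/-- The totally singular subspace spanned by an isotropic set of basis vectors. -/
def coordTS (J : Finset (Fin m ⊕ Fin m)) (hJ : IsotropicSet J) (hk : J.card = k) :
    TotallySingular F m k :=
  ⟨coordSubspace F J, by
    rw [← hk]
    refine finrank_eq_card_of_coordinates _ J (fun v hv h => funext fun x => ?_)
      (fun c => ⟨fun x => if x ∈ J then c x else 0, fun x hx => if_neg hx, fun x hx => if_pos hx⟩)
    by_cases hx : x ∈ J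
    exacts [h x hx, hv x hx], by
    intro u hu v hv
    refine Finset.sum_eq_zero fun i _ => ?_
    by_cases hi : Sum.inl i ∈ J
    · simp [hu _ (hJ i hi), hv _ (hJ i hi)]
    · simp [hu _ hi, hv _ hi]⟩

variable (F k) in
/-- The totally singular coordinate subspaces with index set satisfying `P`. -/
def coordFamily (P : Finset (Fin m ⊕ Fin m) → Prop) : Set (TotallySingular F m k) :=
  {W | ∃ J hJ hk, P J ∧ W = coordTS F J hJ hk}

theorem apply_single_eq_zero {P : Finset (Fin m ⊕ Fin m) → Prop} {γ : GammaSp F m}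
    (hγ : ∀ W ∈ coordFamily F k P, γ • W = W) {J : Finset (Fin m ⊕ Fin m)} (hJ : IsotropicSet J)
    (hk : J.card = k) (hP : P J) {x y : Fin m ⊕ Fin m} (hx : x ∈ J) (hy : y ∉ J) :
    γ.1 (Pi.single x 1) y = 0 :=
  smul_eq_iff.1 (hγ _ ⟨J, hJ, hk, hP, rfl⟩) _ (single_mem_coordSubspace hx) y hy

/-- The maximal isotropic set choosing `f_i` if `s i` and `e_i` otherwise. -/
def transversal (s : Fin m → Bool) : Finset (Fin m ⊕ Fin m) :=
  Finset.univ.image fun i => if s i then Sum.inr i else Sum.inl i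

@[simp]
theorem inl_mem_transversal {s : Fin m → Bool} {i : Fin m} :
    Sum.inl i ∈ transversal s ↔ s i = false := by
  simp only [transversal, Finset.mem_image, Finset.mem_univ, true_and]
  constructor
  · rintro ⟨j, hj⟩
    split_ifs at hj with h
    cases hj
    simpa using h
  · intro h
    exact ⟨i, by simp [h]⟩

@[simp]
theorem inr_mem_transversal {s : Fin m → Bool} {i : Fin m} :
    Sum.inr i ∈ transversal s ↔ s i = true := by
  simp only [transversal, Finset.mem_image, Finset.mem_univ, true_and]
  constructor
  · rintro ⟨j, hj⟩
    split_ifs at hj with h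
    cases hj
    exact h
  · intro h
    exact ⟨i, by simp [h]⟩

theorem isotropicSet_transversal (s : Fin m → Bool) : IsotropicSet (transversal s) := by
  intro i hi
  simp_all

theorem card_transversal (s : Fin m → Bool) : (transversal s).card = m := by
  rw [transversal, Finset.card_image_of_injective, Finset.card_univ, Fintype.card_fin]
  intro i j h
  by_cases hi : s i <;> by_cases hj : s j <;> simp_all

theorem IsotropicSet.mono {J M : Finset (Fin m ⊕ Fin m)} (h : IsotropicSet M) (hJ : J ⊆ M) :
    IsotropicSet J := fun i hi hi' => h i (hJ hi) (hJ hi')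

theorem exists_isotropicSet_subset {M : Finset (Fin m ⊕ Fin m)} (hM : IsotropicSet M)
    (hk : 1 ≤ k) (hkM : k ≤ M.card) {x : Fin m ⊕ Fin m} (hx : x ∈ M) :
    ∃ J ⊆ M, IsotropicSet J ∧ J.card = k ∧ x ∈ J := by
  obtain ⟨J, hxJ, hJM, hJ⟩ := Finset.exists_subsuperset_card_eq
    (Finset.singleton_subset_iff.2 hx) (by simpa using hk) hkM
  exact ⟨J, hJM, hM.mono hJM, hJ, Finset.singleton_subset_iff.1 hxJ⟩

/-! ### The two reductions -/

/-- Triviality is tested in all of `ΓSp`, while the nontrivial elements are sought in `Sp`; thus one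
choice of points serves every group between `PSp` and `PΓSp`. -/
theorem not_isIBIS_and_two_le_baseSize [Finite F] (hk : 1 ≤ k) (G : Subgroup (PGammaSp F m))
    (hG : PSp F m ≤ G) (S : Set (TotallySingular F m k)) (ω ω' : TotallySingular F m k)
    (h : ∀ γ : GammaSp F m, (∀ W ∈ S, γ • W = W) → γ • ω = ω → γ ∈ scalars F m)
    (h₁ : ∃ γ ∈ Sp F m, (∀ W ∈ S, γ • W = W) ∧ γ • ω' = ω' ∧ γ ∉ scalars F m)
    (h₂ : ∃ γ ∈ Sp F m, (∀ W ∈ S, γ • W = W) ∧ γ • ω' ≠ ω') :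
    ¬ IsIBIS G (TotallySingular F m k) ∧ 2 ≤ baseSize G (TotallySingular F m k) := by
  have lift : ∀ γ ∈ Sp F m, ∃ g : G, (∀ W : TotallySingular F m k, g • W = γ • W) ∧
      (γ ∉ scalars F m → g ≠ 1) := fun γ hγ =>
    ⟨⟨QuotientGroup.mk γ, hG ⟨γ, hγ, rfl⟩⟩, fun W => rfl, fun hs h1 =>
      hs ((QuotientGroup.eq_one_iff γ).1 (congrArg Subtype.val h1))⟩
  have key := not_isIBIS_of_set (G := G) S ω ω' ?_ ?_ ?_
  · refine ⟨key.1, ?_⟩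
    have : Nonempty (TotallySingular F m k) := ⟨ω⟩
    refine two_le_baseSize key.2 fun W => ?_
    -- A transvection along a vector of the totally singular `W` is the identity on `W`, so the
    -- stabilizer of `W` is not trivial.
    obtain ⟨v, hv, hv0⟩ : ∃ v ∈ W.1, v ≠ 0 := by
      apply W.1.exists_mem_ne_zero_of_ne_bot
      rintro e
      have := W.2.1
      rw [e, finrank_bot] at this
      omega
    obtain ⟨g, hg, hg1⟩ := lift (transvection v) (rootElement_mem_Sp _ _ _ _)
    refine ⟨g, ?_, hg1 ?_⟩
    · rw [hg, smul_eq_iff]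
      intro u hu
      rw [transvection_apply, W.2.2 u hu v hv, zero_smul, add_zero]
      exact hu
    · exact transvection_notMem_scalars hv0
  · rintro ⟨g, hg⟩ hS hω
    obtain ⟨γ, rfl⟩ := QuotientGroup.mk_surjective g
    exact Subtype.ext ((QuotientGroup.eq_one_iff γ).2 (h γ hS hω))
  · obtain ⟨γ, hγ, hS, hω, hs⟩ := h₁
    obtain ⟨g, hg, hg1⟩ := lift γ hγ
    exact ⟨g, fun W hW => (hg W).trans (hS W hW), (hg _).trans hω, hg1 hs⟩
  · obtain ⟨γ, hγ, hS, hω⟩ := h₂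
    obtain ⟨g, hg, -⟩ := lift γ hγ
    exact ⟨g, fun W hW => (hg W).trans (hS W hW), fun e => hω ((hg _).symm.trans e)⟩

end Basics

end Sympl

/-! ### Large tori: `q ≥ 4`, or `q = 3` and `d ≥ 6` -/

namespace Sympl

section Frame

variable {F : Type*} [Field F] {n k : ℕ}

/-- The stabilizer of all coordinate subspaces is diagonal. -/
theorem apply_single_of_fix_all {m : ℕ} (hk : 1 ≤ k) (hkm : k ≤ m) {γ : GammaSp F m}
    (hγ : ∀ W ∈ coordFamily F k (fun _ : Finset (Fin m ⊕ Fin m) => True), γ • W = W)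
    {x y : Fin m ⊕ Fin m} (hxy : y ≠ x) : γ.1 (Pi.single x 1) y = 0 := by
  let idx : Fin m ⊕ Fin m → Fin m := Sum.elim id id
  -- A maximal isotropic set containing `x` but not `y`: choose `x` in its own hyperbolic pair and
  -- the partner of `y`'s type in all others. If `y` is the partner of `x`, choosing `x` already
  -- excludes it.
  let s : Fin m → Bool := fun i => if i = idx x then x.isRight else !y.isRight
  have hx : x ∈ transversal s := by
    rcases x with i | i <;> simp [s, idx]
  have hy : y ∉ transversal s := by
    rcases x with i | i <;> rcases y with j | j <;> simp [s, idx] at hxy ⊢ <;> tauto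
  obtain ⟨J, hJs, hJ, hJk, hxJ⟩ := exists_isotropicSet_subset (isotropicSet_transversal s) hk
    (by rwa [card_transversal]) hx
  exact apply_single_eq_zero hγ hJ hJk trivial hxJ fun h => hy (hJs h)

/-- A semisimilarity which is diagonal with respect to the standard basis. -/
theorem exists_diagonal {m : ℕ} {γ : GammaSp F m} {σ : F ≃+* F} {c : F} (hc : c ≠ 0)
    (hσ : ∀ (a : F) v, γ.1 (a • v) = σ a • γ.1 v)
    (hf : ∀ u v, form (γ.1 u) (γ.1 v) = c * σ (form u v))
    (h : ∀ x y, y ≠ x → γ.1 (Pi.single x 1) y = 0) :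
    ∃ a : Fin m ⊕ Fin m → F, (∀ x, a x ≠ 0) ∧ (∀ v x, γ.1 v x = σ (v x) * a x) ∧
      ∀ i, a (Sum.inl i) * a (Sum.inr i) = c := by
  have hs : ∀ x, γ.1 (Pi.single x 1) = γ.1 (Pi.single x 1) x • Pi.single x 1 := by
    intro x
    funext y
    by_cases hy : y = x
    · subst hy
      simp
    · simp [h x y hy, hy]
  have hm : ∀ i, γ.1 (Pi.single (Sum.inl i) 1) (Sum.inl i) *
      γ.1 (Pi.single (Sum.inr i) 1) (Sum.inr i) = c := by
    intro i
    have := hf (Pi.single (Sum.inl i) 1) (Pi.single (Sum.inr i) 1)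
    rw [hs, hs (Sum.inr i), form_smul_left, form_smul_right, form_single_inl_left] at this
    simpa using this
  refine ⟨fun x => γ.1 (Pi.single x 1) x, ?_, fun v x => ?_, hm⟩
  · rintro (i | i) h0
    · dsimp only at h0
      exact hc (by rw [← hm i, h0, zero_mul])
    · dsimp only at h0
      exact hc (by rw [← hm i, h0, mul_zero])
  · rw [map_eq_sum γ hσ v, Finset.sum_apply, Finset.sum_eq_single x]
    · rfl
    · intro y _ hy
      simp [h y x hy.symm]
    · simp

variable (n k) in
/-- The indices of `e_0, …, e_{k-1}`. -/
def initialIndices : Finset (Fin n ⊕ Fin n) :=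
  Finset.univ.filter fun x => ∃ i : Fin n, x = Sum.inl i ∧ i.1 < k

theorem card_initialIndices (h : k ≤ n) : (initialIndices n k).card = k := by
  have : initialIndices n k =
      (Finset.univ : Finset (Fin k)).image fun i => Sum.inl (Fin.castLE h i) := by
    ext x
    simp only [initialIndices, Finset.mem_filter, Finset.mem_univ, true_and, Finset.mem_image]
    constructor
    · rintro ⟨i, rfl, hi⟩
      exact ⟨⟨i, hi⟩, rfl⟩
    · rintro ⟨i, rfl⟩
      exact ⟨_, rfl, i.2⟩
  rw [this, Finset.card_image_of_injective, Finset.card_univ, Fintype.card_fin]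
  intro i j hij
  simpa using hij

@[simp]
theorem inl_mem_initialIndices {i : Fin n} : Sum.inl i ∈ initialIndices n k ↔ i.1 < k := by
  simp [initialIndices]

@[simp]
theorem inr_mem_initialIndices {i : Fin n} : Sum.inr i ∉ initialIndices n k := by
  simp [initialIndices]

/-- The sum of the first `k` coordinates. -/
def initialSum (k : ℕ) (v : Space F n) : F := ∑ i : Fin n, if i.1 < k then v (Sum.inl i) else 0

theorem initialSum_add (u v : Space F n) :
    initialSum k (u + v) = initialSum k u + initialSum k v := by
  simp only [initialSum, ← Finset.sum_add_distrib]
  exact Finset.sum_congr rfl fun i _ => by split_ifs <;> simp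

theorem initialSum_smul (a : F) (v : Space F n) :
    initialSum k (a • v) = a * initialSum k v := by
  simp only [initialSum, Finset.mul_sum]
  exact Finset.sum_congr rfl fun i _ => by split_ifs <;> simp

variable (k) in
/-- A totally singular subspace, spanned by
`e_i + ∑_{j ≥ k} e_j + ∑_j f_j + δ_{i0} (l - 1) f_0` for `i < k`. -/
def graphSubspace (l : F) : Submodule F (Space F (n + 2)) where
  carrier := {v | (∀ j : Fin (n + 2), k ≤ j.1 → v (Sum.inl j) = initialSum k v) ∧
    ∀ j, v (Sum.inr j) = initialSum k v + if j = 0 then (l - 1) * v (Sum.inl 0) else 0}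
  zero_mem' := by simp [initialSum]
  add_mem' := by
    rintro u v ⟨hu, hu'⟩ ⟨hv, hv'⟩
    refine ⟨fun j hj => ?_, fun j => ?_⟩
    · rw [initialSum_add, Pi.add_apply, hu j hj, hv j hj]
    · rw [initialSum_add, Pi.add_apply, hu', hv']
      split_ifs
      · simp
        ring
      · ring
  smul_mem' := by
    rintro a v ⟨hv, hv'⟩
    refine ⟨fun j hj => ?_, fun j => ?_⟩
    · rw [initialSum_smul, Pi.smul_apply, hv j hj, smul_eq_mul]
    · rw [initialSum_smul, Pi.smul_apply, hv', smul_eq_mul]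
      split_ifs
      · simp
        ring
      · ring

theorem mem_graphSubspace {l : F} {v : Space F (n + 2)} :
    v ∈ graphSubspace k l ↔ (∀ j : Fin (n + 2), k ≤ j.1 → v (Sum.inl j) = initialSum k v) ∧
    ∀ j, v (Sum.inr j) = initialSum k v + if j = 0 then (l - 1) * v (Sum.inl 0) else 0 := Iff.rfl

theorem finrank_graphSubspace (hk : k ≤ n + 2) (l : F) :
    Module.finrank F (graphSubspace k l : Submodule F (Space F (n + 2))) = k := by
  rw [finrank_eq_card_of_coordinates _ (initialIndices (n + 2) k), card_initialIndices hk]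
  · intro v hv h
    have h' : ∀ i : Fin (n + 2), i.1 < k → v (Sum.inl i) = 0 := fun i hi => h _ (by simpa using hi)
    have h0 : initialSum k v = 0 := Finset.sum_eq_zero fun i _ => by
      split_ifs with hi
      exacts [h' i hi, rfl]
    have h1 : ∀ i, v (Sum.inl i) = 0 := fun i => by
      by_cases hi : i.1 < k
      exacts [h' i hi, (hv.1 i (not_lt.1 hi)).trans h0]
    funext x
    rcases x with i | i
    · exact h1 i
    · rw [hv.2 i, h0, h1]
      simp
  · intro c
    have hs : ∀ v : Space F (n + 2), (∀ i : Fin (n + 2), i.1 < k → v (Sum.inl i) = c (Sum.inl i)) →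
        initialSum k v = initialSum k c := fun v hv => Finset.sum_congr rfl fun i _ => by
      split_ifs with hi
      exacts [hv i hi, rfl]
    let a : Fin (n + 2) → F := fun i => if i.1 < k then c (Sum.inl i) else initialSum k c
    let v : Space F (n + 2) := Sum.elim a
      fun j => initialSum k c + if j = 0 then (l - 1) * a 0 else 0
    have hv : initialSum k v = initialSum k c := hs v fun i hi => by simp [v, a, hi]
    refine ⟨v, ⟨fun j hj => ?_, fun j => ?_⟩, ?_⟩
    · rw [hv]
      simp [v, a, not_lt.2 hj]
    · rw [hv]
      rfl
    · rintro (i | i) hi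
      · simp only [inl_mem_initialIndices] at hi
        simp [v, a, hi]
      · simp at hi

/-- With `S` the initial sum, the contribution of the `i`-th hyperbolic pair is `u_i S(v) - S(u)
v_i` for `i < k` and zero otherwise, since the terms with `l - 1` cancel. These add up to `S(u) S(v)
- S(u) S(v)`. -/
theorem form_graphSubspace {l : F} {u v : Space F (n + 2)} (hu : u ∈ graphSubspace k l)
    (hv : v ∈ graphSubspace k l) : form u v = 0 := by
  have key : ∀ i : Fin (n + 2), u (Sum.inl i) * v (Sum.inr i) - u (Sum.inr i) * v (Sum.inl i) =
      (if i.1 < k then u (Sum.inl i) else 0) * initialSum k v -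
        initialSum k u * if i.1 < k then v (Sum.inl i) else 0 := by
    intro i
    rw [hu.2 i, hv.2 i]
    by_cases hi : i.1 < k
    · by_cases h0 : i = 0
      · subst h0
        rw [if_pos hi, if_pos hi, if_pos rfl, if_pos rfl]
        ring
      · rw [if_pos hi, if_pos hi, if_neg h0, if_neg h0]
        ring
    · rw [if_neg hi, if_neg hi, hu.1 i (not_lt.1 hi), hv.1 i (not_lt.1 hi)]
      split_ifs with h0
      · subst h0
        rw [hu.1 0 (not_lt.1 hi), hv.1 0 (not_lt.1 hi)]
        ring
      · ring
  rw [form, Finset.sum_congr rfl fun i _ => key i, Finset.sum_sub_distrib, ← Finset.sum_mul,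
    ← Finset.mul_sum]
  exact sub_self _

variable (k) in
/-- The totally singular subspace of vectors with `v(f_0) = v(e_1)`, `v(f_1) = v(e_0)` and
all other coordinates outside `e_0, …, e_{k-1}` zero. -/
def swapSubspace (F : Type*) [Field F] (n : ℕ) : Submodule F (Space F (n + 2)) where
  carrier := {v | (∀ j : Fin (n + 2), k ≤ j.1 → v (Sum.inl j) = 0) ∧
    ∀ j, v (Sum.inr j) = if j.1 < 2 then v (Sum.inl (Equiv.swap 0 1 j)) else 0}
  zero_mem' := by simp
  add_mem' := by
    rintro u v ⟨hu, hu'⟩ ⟨hv, hv'⟩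
    refine ⟨fun j hj => ?_, fun j => ?_⟩
    · rw [Pi.add_apply, hu j hj, hv j hj, add_zero]
    · rw [Pi.add_apply, hu', hv']
      split_ifs <;> simp
  smul_mem' := by
    rintro a v ⟨hv, hv'⟩
    refine ⟨fun j hj => ?_, fun j => ?_⟩
    · rw [Pi.smul_apply, hv j hj, smul_zero]
    · rw [Pi.smul_apply, hv']
      split_ifs <;> simp

theorem finrank_swapSubspace (hk : k ≤ n + 2) : Module.finrank F (swapSubspace k F n) = k := by
  rw [finrank_eq_card_of_coordinates _ (initialIndices (n + 2) k), card_initialIndices hk]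
  · intro v hv h
    have h1 : ∀ i, v (Sum.inl i) = 0 := fun i => by
      by_cases hi : i.1 < k
      exacts [h _ (by simpa using hi), hv.1 i (not_lt.1 hi)]
    funext x
    rcases x with i | i
    · exact h1 i
    · rw [hv.2 i, h1]
      simp
  · intro c
    let a : Fin (n + 2) → F := fun i => if i.1 < k then c (Sum.inl i) else 0
    refine ⟨Sum.elim a fun j => if j.1 < 2 then a (Equiv.swap 0 1 j) else 0,
      ⟨fun j hj => ?_, fun j => rfl⟩, ?_⟩
    · simp [a, not_lt.2 hj]
    · rintro (i | i) hi
      · simp only [inl_mem_initialIndices] at hi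
        simp [a, hi]
      · simp at hi

theorem form_swapSubspace {u v : Space F (n + 2)} (hu : u ∈ swapSubspace k F n)
    (hv : v ∈ swapSubspace k F n) : form u v = 0 := by
  have key : ∀ w ∈ swapSubspace k F n, w (Sum.inr 0) = w (Sum.inl 1) ∧
      w (Sum.inr 1) = w (Sum.inl 0) ∧ ∀ i : Fin n, w (Sum.inr i.succ.succ) = 0 := by
    intro w hw
    refine ⟨by simp [hw.2 0], by simp [hw.2 1], fun i => by simp [hw.2 i.succ.succ]⟩
  obtain ⟨hu0, hu1, hu2⟩ := key u hu
  obtain ⟨hv0, hv1, hv2⟩ := key v hv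
  rw [form, Fin.sum_univ_succ, Fin.sum_univ_succ, Finset.sum_eq_zero fun i _ => by
    rw [hu2, hv2]; ring]
  simp only [Fin.succ_zero_eq_one, hu0, hu1, hv0, hv1]
  ring

/-- Take a generator of the cyclic group `Fˣ`. -/
theorem exists_generator (F : Type*) [Field F] [Finite F] :
    ∃ l : F, ∀ σ : F ≃+* F, σ l = l → ∀ a, σ a = a := by
  obtain ⟨l, hl⟩ := IsCyclic.exists_generator (α := Fˣ)
  refine ⟨l, fun σ h a => ?_⟩
  by_cases ha : a = 0
  · rw [ha, map_zero]
  obtain ⟨z, hz⟩ := Subgroup.mem_zpowers_iff.1 (hl (Units.mk0 a ha))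
  have : a = (l : F) ^ z := by rw [← Units.val_zpow_eq_zpow_val, hz, Units.val_mk0]
  rw [this, map_zpow₀, h]

/-- Such a `γ` is diagonal up to `σ`. Comparing coordinates in the images of the spanning vectors of
the graph makes all diagonal entries equal, and the coefficient `l` then yields `σ l = l`, which
excludes field automorphisms. -/
theorem mem_scalars_of_fix_graph (hk : 1 ≤ k) (hkm : k ≤ n + 2) {l : F}
    (hl : ∀ σ : F ≃+* F, σ l = l → ∀ a, σ a = a) {γ : GammaSp F (n + 2)}
    (hγ : ∀ W ∈ coordFamily F k (fun _ : Finset (Fin (n + 2) ⊕ Fin (n + 2)) => True), γ • W = W)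
    (hl' : ∀ v ∈ graphSubspace k l, γ.1 v ∈ graphSubspace k l) : γ ∈ scalars F (n + 2) := by
  obtain ⟨-, σ, c, hc, hσ, hf⟩ := γ.2
  obtain ⟨a, ha0, ha, hac⟩ := exists_diagonal hc hσ hf
    fun x y hxy => apply_single_of_fix_all hk hkm hγ hxy
  have hk' : 0 < k := hk
  have basis : ∀ i : Fin (n + 2), i.1 < k →
      (∀ j : Fin (n + 2), k ≤ j.1 → a (Sum.inl j) = a (Sum.inl i)) ∧
      ∀ j, (if j = 0 ∧ i = 0 then σ l else 1) * a (Sum.inr j) =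
        (if j = 0 ∧ i = 0 then l else 1) * a (Sum.inl i) := by
    intro i hi
    -- The `i`-th spanning vector of the graph; its image is again in the graph, with initial sum `a
    -- (Sum.inl i)`.
    let v : Space F (n + 2) := Sum.elim (fun j => if j.1 < k then (if j = i then 1 else 0) else 1)
      (fun j => if j = 0 ∧ i = 0 then l else 1)
    have sum_eq : ∀ b : Fin (n + 2) → F,
        (∑ j : Fin (n + 2), if j.1 < k then (if j = i then b j else 0) else 0) = b i := by
      intro b
      rw [Finset.sum_eq_single i]
      · simp [hi]
      · intro j _ hj
        simp [hj]
      · simp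
    have hvs : initialSum k v = 1 := by
      rw [← sum_eq fun _ => 1]
      refine Finset.sum_congr rfl fun j _ => ?_
      by_cases hj : j.1 < k <;> simp [v, hj]
    have hv : v ∈ graphSubspace k l := by
      refine ⟨fun j hj => ?_, fun j => ?_⟩
      · rw [hvs]
        simp [v, not_lt.2 hj]
      · rw [hvs]
        by_cases hj : j = 0 <;> by_cases hi0 : i = 0 <;> simp [v, hj, hi0, eq_comm, hk']
    have h := hl' v hv
    have hs : initialSum k (γ.1 v) = a (Sum.inl i) := by
      rw [← sum_eq fun j => a (Sum.inl j)]
      refine Finset.sum_congr rfl fun j _ => ?_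
      by_cases hj : j.1 < k <;> by_cases hji : j = i <;> simp [v, hj, hji, ha]
    have h1 := h.1
    have h2 := h.2
    rw [hs] at h1 h2
    refine ⟨fun j hj => ?_, fun j => ?_⟩
    · have := h1 j hj
      rw [ha] at this
      simpa [v, not_lt.2 hj] using this
    · have := h2 j
      rw [ha, ha] at this
      by_cases hj : j = 0 <;> by_cases hi0 : i = 0
      · subst hj hi0
        simp [v, hk'] at this ⊢
        rw [this]
        ring
      · subst hj
        simpa [v, hi0, hk', Ne.symm hi0] using this
      · simpa [v, hi0, hj] using this
      · simpa [v, hi0, hj] using this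
  have b0 := basis 0 hk
  set s := a (Sum.inl 0) with hs
  have hr : ∀ j ≠ 0, a (Sum.inr j) = s := fun j hj => by simpa [hj] using b0.2 j
  have h10 : (1 : Fin (n + 2)) ≠ 0 := by simp
  have hle : ∀ i, a (Sum.inl i) = s := by
    intro i
    by_cases hi : i.1 < k
    · have := (basis i hi).2 1
      rw [hr 1 h10] at this
      simpa [h10] using this.symm
    · exact b0.1 i (not_lt.1 hi)
  have hr' : ∀ j, a (Sum.inr j) = s := by
    intro j
    by_cases hj : j = 0
    · subst hj
      -- The graph only gives `σ l * a (Sum.inr 0) = l * s`. The entry at `f_0` is found instead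
      -- from the multiplier `c`, which is the product of the two entries in each hyperbolic pair.
      have h0 := hac 0
      rw [← hac 1, hle 1, hle 0, hr 1 h10] at h0
      exact mul_left_cancel₀ (ha0 _) h0
    · exact hr j hj
  have hσl : σ l = l := by
    have := b0.2 0
    simp only [and_self, if_true, hr'] at this
    exact mul_right_cancel₀ (ha0 _) this
  refine mem_scalars_of_single γ hσ (hl σ hσl) (ha0 (Sum.inl 0)) fun x => funext fun y => ?_
  rw [ha, hl σ hσl]
  have : a y = s := by rcases y with j | j <;> [exact hle j; exact hr' j]
  rw [this, mul_comm]
  rfl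

theorem torusElement_smul {m : ℕ} (a : Fin m → Fˣ)
    {P : Finset (Fin m ⊕ Fin m) → Prop} :
    ∀ W ∈ coordFamily F k P, torusElement a • W = W := by
  rintro _ ⟨J, hJ, hk, -, rfl⟩
  rw [smul_eq_iff]
  intro v hv x hx
  rcases x with i | i
  · rw [torusElement_inl, hv _ hx, mul_zero]
  · rw [torusElement_inr, hv _ hx, mul_zero]

theorem torusElement_notMem_scalars {m : ℕ} {a : Fin m → Fˣ} {i j : Fin m}
    (h : a i ≠ a j ∨ a i ≠ (a j)⁻¹) : torusElement a ∉ scalars F m := by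
  rintro ⟨s, hs, hsc⟩
  have h1 : ∀ i, (a i : F) = s := fun i => by
    simpa using congrFun (hsc (Pi.single (Sum.inl i) 1)) (Sum.inl i)
  have h2 : ∀ i, ((a i)⁻¹ : Fˣ) = s := fun i => by
    simpa using congrFun (hsc (Pi.single (Sum.inr i) 1)) (Sum.inr i)
  rcases h with h | h
  · exact h (Units.ext ((h1 i).trans (h1 j).symm))
  · exact h (Units.ext ((h1 i).trans (h2 j).symm))

/-- The relations tie `f_0` to `e_1` and `f_1` to `e_0`, so invariance amounts to `a_0⁻¹ = a_1` and
`a_1⁻¹ = a_0`. -/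
theorem torusElement_fix_swapSubspace {a : Fin (n + 2) → Fˣ} (h : a 0 * a 1 = 1)
    {v : Space F (n + 2)} (hv : v ∈ swapSubspace k F n) :
    (torusElement a).1 v ∈ swapSubspace k F n := by
  refine ⟨fun j hj => by rw [torusElement_inl, hv.1 j hj, mul_zero], fun j => ?_⟩
  rw [torusElement_inr, hv.2 j, torusElement_inl]
  split_ifs with h2
  · congr 2
    have : j = 0 ∨ j = 1 := by
      rcases j with ⟨j, hj⟩
      simp only [Fin.ext_iff, Fin.val_zero, Fin.val_one]
      simp only at h2
      omega
    rcases this with rfl | rfl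
    · rw [Equiv.swap_apply_left]
      exact inv_eq_of_mul_eq_one_right h
    · rw [Equiv.swap_apply_right]
      exact inv_eq_of_mul_eq_one_left h
  · rw [mul_zero]

theorem exists_torusElement_not_fix_swapSubspace (hk : 1 ≤ k) {a : Fˣ} (ha : a ≠ 1) :
    ∃ v ∈ swapSubspace k F n,
      (torusElement fun i => if i = 0 then a else 1).1 v ∉ swapSubspace k F n := by
  -- The vector `e_0 + f_1` lies in the subspace for every `k ≥ 1`, even when `e_1` is not among the
  -- free coordinates.
  refine ⟨Pi.single (Sum.inl 0) 1 + Pi.single (Sum.inr 1) 1, ⟨fun j hj => ?_, fun j => ?_⟩, ?_⟩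
  · have : j ≠ 0 := by
      rintro rfl
      exact absurd hj (not_le.2 hk)
    simp [this]
  · by_cases h1 : j = 1
    · subst h1
      simp
    · by_cases h0 : j = 0
      · subst h0
        simp
      · rw [Equiv.swap_apply_of_ne_of_ne h0 h1]
        simp [h0, h1]
  · intro h
    have := h.2 1
    rw [torusElement_inr] at this
    simp at this
    exact ha (Units.ext this.symm)

/-- The case where the torus is large enough. -/
theorem not_isIBIS_of_torus [Finite F] (hk : 1 ≤ k) (hkm : k ≤ n + 2)
    (G : Subgroup (PGammaSp F (n + 2))) (hG : PSp F (n + 2) ≤ G)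
    (hF : 4 ≤ Nat.card F ∨ 3 ≤ Nat.card F ∧ 1 ≤ n) :
    ¬ IsIBIS G (TotallySingular F (n + 2) k) ∧
      2 ≤ baseSize G (TotallySingular F (n + 2) k) := by
  obtain ⟨l, hl⟩ := exists_generator F
  have hcard := Nat.card_units F
  have : Nontrivial Fˣ := Finite.one_lt_card_iff_nontrivial.1 (by omega)
  obtain ⟨a, ha⟩ := exists_ne (1 : Fˣ)
  refine not_isIBIS_and_two_le_baseSize hk G hG (coordFamily F k fun _ => True)
    ⟨graphSubspace k l, finrank_graphSubspace hkm l, fun u hu v hv => form_graphSubspace hu hv⟩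
    ⟨swapSubspace k F n, finrank_swapSubspace hkm, fun u hu v hv => form_swapSubspace hu hv⟩
    (fun γ hγ hω => mem_scalars_of_fix_graph hk hkm hl hγ (smul_eq_iff.1 hω)) ?_ ?_
  · have key : ∃ a : Fin (n + 2) → Fˣ, a 0 * a 1 = 1 ∧ torusElement a ∉ scalars F (n + 2) := by
      -- A nonscalar torus element with `a_0 a_1 = 1`. If `q ≥ 4`, a generator of `Fˣ` has order at
      -- least `3` and differs from its inverse; otherwise there is a third hyperbolic pair on which
      -- to act.
      rcases hF with hF | ⟨-, hn⟩
      · obtain ⟨b, hb⟩ : ∃ b : Fˣ, b ≠ b⁻¹ := by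
          obtain ⟨l, hl⟩ := IsCyclic.exists_generator (α := Fˣ)
          refine ⟨l, fun h => ?_⟩
          have h2 : l ^ 2 = 1 := by
            rw [pow_two]
            exact mul_eq_one_iff_eq_inv.2 h
          have := orderOf_le_of_pow_eq_one two_pos h2
          rw [orderOf_eq_card_of_forall_mem_zpowers hl] at this
          omega
        refine ⟨fun i => if i = 0 then b else if i = 1 then b⁻¹ else 1, by simp,
          torusElement_notMem_scalars (i := 0) (j := 1) ?_⟩
        left
        simpa using hb
      · refine ⟨fun i => if i.1 = 2 then a else 1, by simp,
          torusElement_notMem_scalars (i := 0) (j := ⟨2, by omega⟩) ?_⟩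
        left
        simpa using ha.symm
    obtain ⟨b, hb, hbs⟩ := key
    exact ⟨torusElement b, torusElement_mem_Sp b, torusElement_smul b,
      smul_eq_iff.2 fun v hv => torusElement_fix_swapSubspace hb hv, hbs⟩
  · obtain ⟨v, hv, hv'⟩ := exists_torusElement_not_fix_swapSubspace (n := n) hk ha
    exact ⟨torusElement _, torusElement_mem_Sp _, torusElement_smul _,
      fun h => hv' (smul_eq_iff.1 h v hv)⟩

end Frame

end Sympl

/-! ### Negative cases over `𝔽₂`, and dimension four over odd prime fields -/

namespace Sympl

section SmallFields

variable {F : Type*} [Field F] {m n k : ℕ}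

theorem ringEquiv_apply_of_card_prime {p : ℕ} (hp : p.Prime) (hF : Nat.card F = p) (σ : F ≃+* F)
    (a : F) : σ a = a := by
  have := Fact.mk hp
  obtain ⟨z, hz⟩ := AddSubgroup.mem_zmultiples_iff.1
    (mem_zmultiples_of_prime_card hF (one_ne_zero (α := F)) (g' := a))
  rw [← hz, map_zsmul, map_one]

theorem eq_one_of_card_eq_two (hF : Nat.card F = 2) {a : F} (ha : a ≠ 0) : a = 1 := by
  obtain ⟨y, -, hy⟩ := (Nat.card_eq_two_iff' (0 : F)).1 hF
  rw [hy a ha, hy 1 one_ne_zero]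

theorem form_map_of_card_eq_two (hF : Nat.card F = 2) (γ : GammaSp F m) (u v : Space F m) :
    form (γ.1 u) (γ.1 v) = form u v := by
  obtain ⟨-, σ, c, hc, -, hf⟩ := γ.2
  rw [hf, eq_one_of_card_eq_two hF hc, one_mul,
    ringEquiv_apply_of_card_prime Nat.prime_two hF]

theorem apply_single_ne_zero (γ : GammaSp F m) (x : Fin m ⊕ Fin m) :
    γ.1 (Pi.single x 1) ≠ 0 := fun h => by
  have := γ.1.injective (h.trans (map_zero' γ).symm)
  simp at this

theorem apply_single_of_card_eq_two (hF : Nat.card F = 2) {γ : GammaSp F m} {x : Fin m ⊕ Fin m}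
    (h : ∀ y, y ≠ x → γ.1 (Pi.single x 1) y = 0) : γ.1 (Pi.single x 1) = Pi.single x 1 := by
  funext y
  by_cases hy : y = x
  · subst hy
    rw [Pi.single_eq_same]
    refine eq_one_of_card_eq_two hF fun h0 => apply_single_ne_zero γ y (funext fun z => ?_)
    by_cases hz : z = y
    · rw [hz, h0]
      rfl
    · exact h z hz
  · rw [h y hy, Pi.single_eq_of_ne hy]

/-- Up to sign, the `f_i`-coordinate is the pairing with `e_i`, and over `𝔽₂` every semisimilarity
is an isometry. -/
theorem apply_inr_of_fix (hF : Nat.card F = 2) {γ : GammaSp F m} {i : Fin m}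
    (h : γ.1 (Pi.single (Sum.inl i) 1) = Pi.single (Sum.inl i) 1) (v : Space F m) :
    γ.1 v (Sum.inr i) = v (Sum.inr i) := by
  have := form_map_of_card_eq_two hF γ v (Pi.single (Sum.inl i) 1)
  rwa [h, form_single_inl_right, form_single_inl_right, neg_inj] at this

theorem apply_inl_of_fix (hF : Nat.card F = 2) {γ : GammaSp F m} {i : Fin m}
    (h : γ.1 (Pi.single (Sum.inr i) 1) = Pi.single (Sum.inr i) 1) (v : Space F m) :
    γ.1 v (Sum.inl i) = v (Sum.inl i) := by
  have := form_map_of_card_eq_two hF γ v (Pi.single (Sum.inr i) 1)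
  rwa [h, form_single_inr_right, form_single_inr_right] at this

theorem mem_scalars_of_fix_single {p : ℕ} (hp : p.Prime) (hF : Nat.card F = p) {γ : GammaSp F m}
    {s : F} (hs : s ≠ 0) (h : ∀ x, γ.1 (Pi.single x 1) = s • Pi.single x 1) :
    γ ∈ scalars F m := by
  obtain ⟨-, σ, c, hc, hσ, -⟩ := γ.2
  exact mem_scalars_of_single γ hσ (ringEquiv_apply_of_card_prime hp hF σ) hs h

theorem transvection_single_fix {J : Finset (Fin m ⊕ Fin m)} {i : Fin m} (hi : Sum.inr i ∉ J)
    (v : Space F m) (hv : v ∈ coordSubspace F J) :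
    (transvection (Pi.single (Sum.inl i) 1)).1 v ∈ coordSubspace F J := by
  rw [transvection_apply, form_single_inl_right, hv _ hi, neg_zero, zero_smul, add_zero]
  exact hv

theorem transvection_single_smul {P : Finset (Fin m ⊕ Fin m) → Prop} {i : Fin m}
    (hP : ∀ J, P J → Sum.inr i ∉ J) :
    ∀ W ∈ coordFamily F k P, transvection (Pi.single (Sum.inl i) 1 : Space F m) • W = W := by
  rintro _ ⟨J, hJ, hk, hPJ, rfl⟩
  exact smul_eq_iff.2 fun v hv => transvection_single_fix (hP J hPJ) v hv

theorem transvection_single_not_fix {J : Finset (Fin m ⊕ Fin m)} {i : Fin m} (hJ : IsotropicSet J)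
    (hk : J.card = k) (hi : Sum.inr i ∈ J) :
    transvection (Pi.single (Sum.inl i) 1 : Space F m) • coordTS F J hJ hk ≠ coordTS F J hJ hk := by
  intro h
  have := smul_eq_iff.1 h _ (single_mem_coordSubspace hi) (Sum.inl i) fun h' => hJ i h' hi
  rw [transvection_apply, form_single_inl_right] at this
  simp at this

/-- The case of subspaces over `𝔽₂` which are neither points nor maximal. -/
theorem not_isIBIS_of_card_eq_two_of_lt [Finite F] (hF : Nat.card F = 2) (hk : 2 ≤ k)
    (hkm : k < n + 2) (G : Subgroup (PGammaSp F (n + 2))) (hG : PSp F (n + 2) ≤ G) :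
    ¬ IsIBIS G (TotallySingular F (n + 2) k) ∧
      2 ≤ baseSize G (TotallySingular F (n + 2) k) := by
  have h01 : (0 : Fin (n + 2)) ≠ 1 := by simp
  have ex : ∀ (s : Fin (n + 2) → Bool) (x y : Fin (n + 2) ⊕ Fin (n + 2)), x ∈ transversal s →
      y ∈ transversal s →
      ∃ J ⊆ transversal s, IsotropicSet J ∧ J.card = k ∧ x ∈ J ∧ y ∈ J := by
    intro s x y hx hy
    obtain ⟨J, hJ, hJM, hc⟩ := Finset.exists_subsuperset_card_eq (n := k)
      (Finset.insert_subset hx (Finset.singleton_subset_iff.2 hy))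
      ((Finset.card_insert_le _ _).trans (by simpa using hk)) (by rw [card_transversal]; omega)
    exact ⟨J, hJM, (isotropicSet_transversal s).mono hJM, hc, hJ (by simp), hJ (by simp)⟩
  -- The stabilizer of the family below can only change `f_0` and `f_1`, by vectors of `⟨e_0, e_1⟩`.
  -- A subspace containing `f_0` and `f_1` forbids this. One containing `f_0` and `e_1` still allows
  -- the transvection along `e_1`, but not the one along `e_0`.
  obtain ⟨J, hJs, hJ, hJk, hJ0, hJ1⟩ := ex (fun i => decide (i = 0 ∨ i = 1)) (Sum.inr 0)
    (Sum.inr 1) (by simp) (by simp)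
  obtain ⟨J', hJs', hJ', hJk', hJ0', hJ1'⟩ := ex (fun i => decide (i = 0)) (Sum.inr 0)
    (Sum.inl 1) (by simp) (by simp)
  have hP : ∀ i : Fin (n + 2), i = 0 ∨ i = 1 → ∀ J : Finset (Fin (n + 2) ⊕ Fin (n + 2)),
      (Sum.inr 0 ∉ J ∧ Sum.inr 1 ∉ J) → Sum.inr i ∉ J := by
    rintro i (rfl | rfl) J h
    exacts [h.1, h.2]
  refine not_isIBIS_and_two_le_baseSize (by omega) G hG
    (coordFamily F k fun J => Sum.inr 0 ∉ J ∧ Sum.inr 1 ∉ J)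
    (coordTS F J hJ hJk) (coordTS F J' hJ' hJk') ?_
    ⟨_, rootElement_mem_Sp _ _ _ _, transvection_single_smul (hP 1 (Or.inr rfl)),
      smul_eq_iff.2 fun v hv => transvection_single_fix (hJ' 1 hJ1') v hv,
      transvection_notMem_scalars (by simp)⟩
    ⟨_, rootElement_mem_Sp _ _ _ _, transvection_single_smul (hP 0 (Or.inl rfl)),
      transvection_single_not_fix hJ' hJk' hJ0'⟩
  intro γ hγ hω
  have hfix : ∀ x : Fin (n + 2) ⊕ Fin (n + 2), x ≠ Sum.inr 0 → x ≠ Sum.inr 1 →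
      γ.1 (Pi.single x 1) = Pi.single x 1 := by
    intro x h0 h1
    refine apply_single_of_card_eq_two hF fun y hy => ?_
    let s : Fin (n + 2) → Bool := fun i => decide (Sum.inr i = x)
    have hx : x ∈ transversal s := by rcases x with i | i <;> simp [s]
    -- Since `k < m`, there is room for a `k`-set inside the transversal even after `y` is removed.
    obtain ⟨I, hxI, hIM, hc⟩ := Finset.exists_subsuperset_card_eq (n := k)
      (Finset.singleton_subset_iff.2 (Finset.mem_erase.2 ⟨hy.symm, hx⟩)) (by simp; omega)
      ((by rw [card_transversal]; omega : k ≤ (transversal s).card - 1).trans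
        Finset.pred_card_le_card_erase)
    have hIs := hIM.trans (Finset.erase_subset _ _)
    refine apply_single_eq_zero hγ ((isotropicSet_transversal s).mono hIs) hc
      ⟨fun h => ?_, fun h => ?_⟩ (Finset.singleton_subset_iff.1 hxI)
      fun h => Finset.notMem_erase _ _ (hIM h)
    · exact h0 (by simpa [s, eq_comm] using hIs h)
    · exact h1 (by simpa [s, eq_comm] using hIs h)
  have hinr : ∀ v i, γ.1 v (Sum.inr i) = v (Sum.inr i) := fun v i =>
    apply_inr_of_fix hF (hfix _ (by simp) (by simp)) v
  have hinl : ∀ v i, i ≠ 0 → i ≠ 1 → γ.1 v (Sum.inl i) = v (Sum.inl i) := fun v i h0 h1 =>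
    apply_inl_of_fix hF (hfix _ (by simpa using h0) (by simpa using h1)) v
  have hlast : ∀ i : Fin (n + 2), Sum.inr i ∈ J →
      γ.1 (Pi.single (Sum.inr i) 1) = Pi.single (Sum.inr i) 1 := by
    intro i hi
    have h := smul_eq_iff.1 hω _ (single_mem_coordSubspace hi)
    funext y
    rcases y with j | j
    · by_cases hj : j = 0 ∨ j = 1
      · rw [h]
        · simp
        · rcases hj with rfl | rfl
          exacts [fun h' => hJ _ h' hJ0, fun h' => hJ _ h' hJ1]
      · rw [not_or] at hj
        exact hinl _ j hj.1 hj.2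
    · exact hinr _ j
  refine mem_scalars_of_fix_single Nat.prime_two hF one_ne_zero fun x => ?_
  rw [one_smul]
  by_cases h0 : x = Sum.inr 0
  · exact h0 ▸ hlast 0 hJ0
  by_cases h1 : x = Sum.inr 1
  · exact h1 ▸ hlast 1 hJ1
  exact hfix x h0 h1

theorem mem_coordSubspace_transversal {s : Fin m → Bool} {v : Space F m} :
    v ∈ coordSubspace F (transversal s) ↔
      ∀ i, (s i = true → v (Sum.inl i) = 0) ∧ (s i = false → v (Sum.inr i) = 0) := by
  rw [mem_coordSubspace, Sum.forall, ← forall_and]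
  simp

theorem form_single_inl_single_inl (i j : Fin m) :
    form (Pi.single (Sum.inl i) 1 : Space F m) (Pi.single (Sum.inl j) 1) = 0 := by
  rw [form_single_inl_right]
  simp

/-- The isometry fixing all `e_l` and all `f_l` with `l ≠ i, j`, and sending `f_i` to `f_i - e_j`
and `f_j` to `f_j - e_i`. -/
def siegelElement (F : Type*) [Field F] (i j : Fin m) : GammaSp F m :=
  rootElement (Pi.single (Sum.inl i) 1) (Pi.single (Sum.inl j) 1)
    (form_single_inl_single_inl i j) 0

theorem siegelElement_mem_Sp (i j : Fin m) : siegelElement F i j ∈ Sp F m :=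
  rootElement_mem_Sp _ _ _ _

theorem siegelElement_inr (i j l : Fin m) (v : Space F m) :
    (siegelElement F i j).1 v (Sum.inr l) = v (Sum.inr l) := by
  simp [siegelElement]

theorem siegelElement_inl (i j l : Fin m) (v : Space F m) :
    (siegelElement F i j).1 v (Sum.inl l) = v (Sum.inl l) -
      (if l = j then v (Sum.inr i) else 0) - if l = i then v (Sum.inr j) else 0 := by
  simp only [siegelElement, rootElement_apply, form_single_inl_right, Pi.add_apply, Pi.smul_apply,
    smul_eq_mul, Pi.single_apply, Sum.inl.injEq]
  split_ifs <;> ring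

theorem siegelElement_fix {s : Fin m → Bool} {i j : Fin m} (h : s i = false ∨ s j = false)
    (v : Space F m) (hv : v ∈ coordSubspace F (transversal s)) :
    (siegelElement F i j).1 v ∈ coordSubspace F (transversal s) := by
  rw [mem_coordSubspace_transversal] at hv ⊢
  intro l
  refine ⟨fun hl => ?_, fun hl => ?_⟩
  · rw [siegelElement_inl, (hv l).1 hl]
    have h1 : l = j → v (Sum.inr i) = 0 := by
      rintro rfl
      refine (hv i).2 (h.resolve_right (by simp [hl]))
    have h2 : l = i → v (Sum.inr j) = 0 := by
      rintro rfl
      refine (hv j).2 (h.resolve_left (by simp [hl]))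
    split_ifs with hj hi hi <;> simp_all
  · rw [siegelElement_inr, (hv l).2 hl]

theorem siegelElement_not_fix {s : Fin m → Bool} {i j : Fin m} (hij : i ≠ j) (hi : s i = true)
    (hj : s j = true) (hk : (transversal s).card = k) :
    siegelElement F i j • coordTS F (transversal s) (isotropicSet_transversal s) hk ≠
      coordTS F (transversal s) (isotropicSet_transversal s) hk := by
  intro h
  have := smul_eq_iff.1 h _ (single_mem_coordSubspace (inr_mem_transversal.2 hi)) (Sum.inl j)
    (by simp [hj])
  rw [siegelElement_inl] at this
  simp [hij.symm] at this

/-- The case of maximal totally singular subspaces over `𝔽₂`. -/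
theorem not_isIBIS_of_card_eq_two_of_eq [Finite F] (hF : Nat.card F = 2)
    (G : Subgroup (PGammaSp F (n + 3))) (hG : PSp F (n + 3) ≤ G) :
    ¬ IsIBIS G (TotallySingular F (n + 3) (n + 3)) ∧
      2 ≤ baseSize G (TotallySingular F (n + 3) (n + 3)) := by
  obtain ⟨j, h02, h12⟩ : ∃ j : Fin (n + 3), 0 ≠ j ∧ 1 ≠ j :=
    ⟨⟨2, by omega⟩, by simp [Fin.ext_iff], by simp [Fin.ext_iff]⟩
  have h01 : (0 : Fin (n + 3)) ≠ 1 := by simp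
  -- Transversals with at most one `f`. Their stabilizer fixes every `e_i` and moves each `f_i` by a
  -- combination of the `e_j` with `j ≠ i`. The span of all `f_i` makes it trivial; the transversal
  -- `s` only kills the part pairing the indices `0` and `1`, so a third index is needed.
  let P : Finset (Fin (n + 3) ⊕ Fin (n + 3)) → Prop := fun J =>
    ∃ s, J = transversal s ∧ ∃ i, ∀ j ≠ i, s j = false
  have hsieg : ∀ i j : Fin (n + 3), i ≠ j → ∀ W ∈ coordFamily F (n + 3) P,
      siegelElement F i j • W = W := by
    rintro i j hij _ ⟨_, hJ, hk, ⟨s, rfl, l, hl⟩, rfl⟩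
    refine smul_eq_iff.2 fun v hv => siegelElement_fix ?_ v hv
    by_cases h : i = l
    exacts [Or.inr (hl j fun e => hij (h.trans e.symm)), Or.inl (hl i h)]
  let s : Fin (n + 3) → Bool := fun i => decide (i = 0 ∨ i = 1)
  refine not_isIBIS_and_two_le_baseSize (by omega) G hG (coordFamily F (n + 3) P)
    (coordTS F (transversal fun _ => true) (isotropicSet_transversal _) (card_transversal _))
    (coordTS F (transversal s) (isotropicSet_transversal _) (card_transversal _)) ?_
    ⟨siegelElement F 0 j, siegelElement_mem_Sp _ _, hsieg 0 j h02,
      smul_eq_iff.2 fun v hv => siegelElement_fix (Or.inr (by simp [s, h02.symm, h12.symm])) v hv,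
      ?_⟩
    ⟨siegelElement F 0 1, siegelElement_mem_Sp _ _, hsieg 0 1 h01,
      siegelElement_not_fix h01 (by simp [s]) (by simp [s]) _⟩
  · intro γ hγ hω
    have hfix : ∀ i : Fin (n + 3),
        γ.1 (Pi.single (Sum.inl i) 1) = Pi.single (Sum.inl i) 1 := by
      intro i
      refine apply_single_of_card_eq_two hF fun y hy => ?_
      rcases y with j | j
      · have hij : i ≠ j := fun e => hy (congrArg _ e.symm)
        exact apply_single_eq_zero hγ (isotropicSet_transversal _) (card_transversal _)
          ⟨fun l => decide (l = j), rfl, j, by simp⟩ (by simpa using hij) (by simp)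
      · exact apply_single_eq_zero hγ (isotropicSet_transversal _) (card_transversal _)
          ⟨fun l => false, rfl, j, by simp⟩ (by simp) (by simp)
    refine mem_scalars_of_fix_single Nat.prime_two hF one_ne_zero fun x => ?_
    rw [one_smul]
    rcases x with i | i
    · exact hfix i
    · funext y
      rcases y with j | j
      · have := smul_eq_iff.1 hω _
          (single_mem_coordSubspace (x := Sum.inr i) (by simp))
          (Sum.inl j) (by simp)
        rw [this]
        simp
      · exact apply_inr_of_fix hF (hfix j) _
  · rintro ⟨a, -, ha⟩
    have := congrFun (ha (Pi.single (Sum.inr 0) 1)) (Sum.inl j)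
    rw [siegelElement_inl] at this
    simp [h02.symm] at this

/-- The points of a four-dimensional space over a prime field of odd order. -/
theorem not_isIBIS_points_of_card_prime [Finite F] {p : ℕ} (hp : p.Prime) (hF : Nat.card F = p)
    (h2 : (2 : F) ≠ 0) (G : Subgroup (PGammaSp F 2)) (hG : PSp F 2 ≤ G) :
    ¬ IsIBIS G (TotallySingular F 2 1) ∧ 2 ≤ baseSize G (TotallySingular F 2 1) := by
  have iso : ∀ x : Fin 2 ⊕ Fin 2, IsotropicSet {x} := by
    intro x i hi hi'
    rw [Finset.mem_singleton] at hi hi'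
    rw [← hi] at hi'
    cases hi'
  have hmem : ∀ v : Space F 2, v ∈ (graphSubspace 1 1 : Submodule F (Space F (0 + 2))) ↔
      v (Sum.inl 1) = v (Sum.inl 0) ∧ v (Sum.inr 0) = v (Sum.inl 0) ∧
        v (Sum.inr 1) = v (Sum.inl 0) := by
    intro v
    simp [mem_graphSubspace, initialSum, Fin.forall_fin_two]
  -- `S` consists of `⟨e_0⟩`, `⟨e_1⟩`, `⟨f_0⟩`. The point `ω` is spanned by the all-ones vector.
  -- Adding `⟨f_1⟩` instead removes the transvection along `e_1` but keeps the torus element `(1,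
  -- -1)`.
  refine not_isIBIS_and_two_le_baseSize le_rfl G hG (coordFamily F 1 fun J => Sum.inr 1 ∉ J)
    ⟨graphSubspace (n := 0) 1 1, finrank_graphSubspace (by omega) 1,
      fun u hu v hv => form_graphSubspace hu hv⟩
    (coordTS F {Sum.inr 1} (iso _) (Finset.card_singleton _)) ?_
    ⟨torusElement fun i => if i = 0 then 1 else -1, torusElement_mem_Sp _, torusElement_smul _,
      torusElement_smul (P := fun _ => True) _ _ ⟨_, iso _, Finset.card_singleton _, trivial, rfl⟩,
      torusElement_notMem_scalars (i := 0) (j := 1) (Or.inl fun h => h2 ?_)⟩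
    ⟨_, rootElement_mem_Sp _ _ _ _, transvection_single_smul fun J hJ => hJ,
      transvection_single_not_fix (iso _) (Finset.card_singleton _) (Finset.mem_singleton_self _)⟩
  · intro γ hγ hω
    obtain ⟨-, σ, c, hc, hσ, hf⟩ := γ.2
    have hz : ∀ x y : Fin 2 ⊕ Fin 2, x ≠ Sum.inr 1 → y ≠ x → γ.1 (Pi.single x 1) y = 0 :=
      fun x y hx hy => apply_single_eq_zero hγ (iso x) (Finset.card_singleton x)
        (by simpa using hx.symm) (Finset.mem_singleton_self x) (by simpa using hy)
    let v : Space F 2 := fun _ => 1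
    have hv := smul_eq_iff.1 hω v ((hmem v).2 ⟨rfl, rfl, rfl⟩)
    have hsum : γ.1 v = γ.1 (Pi.single (Sum.inl 0) 1) + γ.1 (Pi.single (Sum.inl 1) 1) +
        γ.1 (Pi.single (Sum.inr 0) 1) + γ.1 (Pi.single (Sum.inr 1) 1) := by
      rw [map_eq_sum γ hσ]
      simp [v, Fin.sum_univ_two, add_assoc]
    rw [hmem, hsum] at hv
    obtain ⟨hv1, hv2, hv3⟩ := hv
    have f00 := hf (Pi.single (Sum.inl 0) 1) (Pi.single (Sum.inr 0) 1)
    have f11 := hf (Pi.single (Sum.inl 1) 1) (Pi.single (Sum.inr 1) 1)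
    have f01 := hf (Pi.single (Sum.inl 0) 1) (Pi.single (Sum.inr 1) 1)
    have g01 := hf (Pi.single (Sum.inr 0) 1) (Pi.single (Sum.inr 1) 1)
    rw [form_single_inl_left] at f00 f11 f01
    rw [form_single_inr_left] at g01
    have z1 := hz (Sum.inl 0)
    have z2 := hz (Sum.inl 1)
    have z3 := hz (Sum.inr 0)
    have n1 := apply_single_ne_zero γ (Sum.inl 0)
    simp only [form, Fin.sum_univ_two, Pi.add_apply, z1, z2, z3, ne_eq, reduceCtorEq,
      not_false_eq_true, Sum.inl.injEq, Sum.inr.injEq, one_ne_zero, zero_ne_one, zero_mul, mul_zero,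
      add_zero, zero_add, sub_zero, zero_sub, Pi.single_eq_same, map_one, map_zero, mul_one,
      Pi.single_apply, if_false, neg_zero] at hv1 hv2 hv3 f00 f11 f01 g01
    set a := γ.1 (Pi.single (Sum.inl 0) 1) (Sum.inl 0) with ha
    have ha0 : a ≠ 0 := by
      intro h
      apply n1
      funext y
      by_cases hy : y = Sum.inl 0
      · rw [hy, ← ha, h]
        rfl
      · exact z1 y (by simp) hy
    have hb0 : γ.1 (Pi.single (Sum.inr 0) 1) (Sum.inr 0) ≠ 0 := by
      intro h
      rw [h, mul_zero] at f00
      exact hc f00.symm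
    -- As `e_0` and `f_0` are kept up to scalars and are orthogonal to `f_1`, the image of `f_1`
    -- lies in `⟨e_1, f_1⟩`.
    have e1 : γ.1 (Pi.single (Sum.inr 1) 1) (Sum.inr 0) = 0 := by
      simpa [ha0] using f01
    have e2 : γ.1 (Pi.single (Sum.inr 1) 1) (Sum.inl 0) = 0 := by
      simpa [hb0] using g01
    rw [e1, e2, add_zero, add_zero] at hv2
    rw [e2, add_zero] at hv3 hv1
    have e3 : γ.1 (Pi.single (Sum.inl 1) 1) (Sum.inl 1) = a := by
      rw [hv3, ← f00, hv2] at f11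
      exact mul_right_cancel₀ ha0 f11
    rw [e3, add_eq_left] at hv1
    refine mem_scalars_of_fix_single hp hF ha0 fun x => funext fun y => ?_
    by_cases hxy : y = x
    · subst hxy
      rw [Pi.smul_apply, Pi.single_eq_same, smul_eq_mul, mul_one]
      rcases y with j | j <;> fin_cases j
      exacts [rfl, e3, hv2, hv3]
    · rw [Pi.smul_apply, Pi.single_eq_of_ne hxy, smul_zero]
      by_cases hx : x = Sum.inr 1
      · subst hx
        rcases y with j | j <;> fin_cases j
        exacts [e2, hv1, e1, absurd rfl hxy]
      · exact hz x y hx hxy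
  · have := congrArg Units.val h
    simp at this
    linear_combination this

/-- The subspace `⟨e_1, e_0 + f_0⟩`. -/
def mixedLine (F : Type*) [Field F] : Submodule F (Space F 2) where
  carrier := {v | v (Sum.inl 0) = v (Sum.inr 0) ∧ v (Sum.inr 1) = 0}
  zero_mem' := by simp
  add_mem' := by
    rintro u v ⟨hu, hu'⟩ ⟨hv, hv'⟩
    simp [hu, hu', hv, hv']
  smul_mem' := by
    rintro a v ⟨hv, hv'⟩
    simp [hv, hv']

theorem mem_mixedLine {v : Space F 2} :
    v ∈ mixedLine F ↔ v (Sum.inl 0) = v (Sum.inr 0) ∧ v (Sum.inr 1) = 0 := Iff.rfl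

/-- The subspace `⟨f_0 + f_1, e_0 - e_1⟩`. -/
def skewLine (F : Type*) [Field F] : Submodule F (Space F 2) where
  carrier := {v | v (Sum.inr 1) = v (Sum.inr 0) ∧ v (Sum.inl 1) = -v (Sum.inl 0)}
  zero_mem' := by simp
  add_mem' := by
    rintro u v ⟨hu, hu'⟩ ⟨hv, hv'⟩
    simp [hu, hu', hv, hv', add_comm]
  smul_mem' := by
    rintro a v ⟨hv, hv'⟩
    simp [hv, hv']

theorem mem_skewLine {v : Space F 2} :
    v ∈ skewLine F ↔ v (Sum.inr 1) = v (Sum.inr 0) ∧ v (Sum.inl 1) = -v (Sum.inl 0) := Iff.rfl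

variable (F) in
theorem finrank_mixedLine : Module.finrank F (mixedLine F) = 2 := by
  rw [finrank_eq_card_of_coordinates (mixedLine F) {Sum.inl 1, Sum.inr 0}]
  · rfl
  · intro v hv h
    rw [mem_mixedLine] at hv
    have h1 := h (Sum.inl 1) (by simp)
    have h2 := h (Sum.inr 0) (by simp)
    funext x
    rcases x with j | j <;> fin_cases j
    exacts [hv.1.trans h2, h1, h2, hv.2]
  · intro c
    refine ⟨Sum.elim ![c (Sum.inr 0), c (Sum.inl 1)] ![c (Sum.inr 0), 0], by simp [mem_mixedLine],
      by simp⟩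

variable (F) in
theorem finrank_skewLine : Module.finrank F (skewLine F) = 2 := by
  rw [finrank_eq_card_of_coordinates (skewLine F) {Sum.inl 0, Sum.inr 0}]
  · rfl
  · intro v hv h
    rw [mem_skewLine] at hv
    have h1 := h (Sum.inl 0) (by simp)
    have h2 := h (Sum.inr 0) (by simp)
    funext x
    rcases x with j | j <;> fin_cases j
    exacts [h1, by simpa [h1] using hv.2, h2, hv.1.trans h2]
  · intro c
    refine ⟨Sum.elim ![c (Sum.inl 0), -c (Sum.inl 0)] ![c (Sum.inr 0), c (Sum.inr 0)],
      by simp [mem_skewLine], by simp⟩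

/-- The lines of a four-dimensional space over a prime field of odd order. -/
theorem not_isIBIS_lines_of_card_prime [Finite F] {p : ℕ} (hp : p.Prime) (hF : Nat.card F = p)
    (h2 : (2 : F) ≠ 0) (G : Subgroup (PGammaSp F 2)) (hG : PSp F 2 ≤ G) :
    ¬ IsIBIS G (TotallySingular F 2 2) ∧ 2 ≤ baseSize G (TotallySingular F 2 2) := by
  -- `S` consists of `⟨f_0, e_1⟩`, `⟨e_0, f_1⟩` and `L`. In its stabilizer, `e_0` and `e_1` are kept
  -- up to scalars, and `f_0`, `f_1` may acquire components along `e_1`, `e_0`. The line `M` leaves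
  -- only scalars, while `⟨f_0, f_1⟩` leaves the torus element `(1, -1)`.
  let s : Fin 2 → Fin 2 → Bool := fun j i => decide (i = j)
  let L : TotallySingular F 2 2 := ⟨mixedLine F, finrank_mixedLine F, fun u hu v hv => by
    rw [mem_mixedLine] at hu hv
    simp only [form, Fin.sum_univ_two, hu, hv]
    ring⟩
  let M : TotallySingular F 2 2 := ⟨skewLine F, finrank_skewLine F, fun u hu v hv => by
    rw [mem_skewLine] at hu hv
    simp only [form, Fin.sum_univ_two, hu, hv]
    ring⟩
  let P : Finset (Fin 2 ⊕ Fin 2) → Prop := fun J => ∃ j, J = transversal (s j)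
  refine not_isIBIS_and_two_le_baseSize (by omega) G hG (insert L (coordFamily F 2 P)) M
    (coordTS F (transversal fun _ => true) (isotropicSet_transversal _) (card_transversal _)) ?_
    ⟨torusElement fun i => if i = 0 then 1 else -1, torusElement_mem_Sp _, ?_,
      torusElement_smul (P := fun _ => True) _ _ ⟨_, _, _, trivial, rfl⟩,
      torusElement_notMem_scalars (i := 0) (j := 1) (Or.inl fun h => h2 ?_)⟩
    ⟨siegelElement F 0 1, siegelElement_mem_Sp _ _, ?_,
      siegelElement_not_fix (by simp) rfl rfl _⟩
  · intro γ hγ hω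
    obtain ⟨-, σ, c, hc, hσ, hf⟩ := γ.2
    have hP : ∀ W ∈ coordFamily F 2 P, γ • W = W := fun W hW => hγ W (Or.inr hW)
    have hz : ∀ x y j, x ∈ transversal (s j) → y ∉ transversal (s j) →
        γ.1 (Pi.single x 1) y = 0 := fun x y j hx hy =>
      apply_single_eq_zero hP (isotropicSet_transversal _) (card_transversal _) ⟨j, rfl⟩ hx hy
    have hL : ∀ v ∈ mixedLine F, γ.1 v ∈ mixedLine F :=
      smul_eq_iff.1 (hγ L (Set.mem_insert _ _))
    have hM : ∀ v ∈ skewLine F, γ.1 v ∈ skewLine F := smul_eq_iff.1 hω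
    have z00 := hz (Sum.inl 0) (Sum.inl 1) 1 (by simp [s]) (by simp [s])
    have z01 := hz (Sum.inl 0) (Sum.inr 0) 1 (by simp [s]) (by simp [s])
    have z10 := hz (Sum.inl 1) (Sum.inl 0) 0 (by simp [s]) (by simp [s])
    have z11 := hz (Sum.inl 1) (Sum.inr 1) 0 (by simp [s]) (by simp [s])
    have w00 := hz (Sum.inr 0) (Sum.inl 0) 0 (by simp [s]) (by simp [s])
    have w01 := hz (Sum.inr 0) (Sum.inr 1) 0 (by simp [s]) (by simp [s])
    have w10 := hz (Sum.inr 1) (Sum.inl 1) 1 (by simp [s]) (by simp [s])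
    have w11 := hz (Sum.inr 1) (Sum.inr 0) 1 (by simp [s]) (by simp [s])
    have hL1 := hL (Pi.single (Sum.inl 1) 1) (by simp [mem_mixedLine])
    have hL2 := hL (Pi.single (Sum.inl 0) 1 + Pi.single (Sum.inr 0) 1) (by simp [mem_mixedLine])
    have hM1 := hM (Pi.single (Sum.inr 0) 1 + Pi.single (Sum.inr 1) 1) (by simp [mem_skewLine])
    have f00 := hf (Pi.single (Sum.inl 0) 1) (Pi.single (Sum.inr 0) 1)
    have f11 := hf (Pi.single (Sum.inl 1) 1) (Pi.single (Sum.inr 1) 1)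
    have f01 := hf (Pi.single (Sum.inr 0) 1) (Pi.single (Sum.inr 1) 1)
    rw [form_single_inl_left] at f00 f11
    rw [form_single_inr_left] at f01
    rw [γ.2.1, mem_mixedLine] at hL2
    rw [γ.2.1, mem_skewLine] at hM1
    rw [mem_mixedLine] at hL1
    simp only [form, Fin.sum_univ_two, Pi.add_apply, z00, z01, z10, z11, w00, w01, w10, w11,
      mul_zero, add_zero, zero_add, sub_zero, zero_sub, Pi.single_eq_same, map_one,
      map_zero, mul_one, ne_eq, reduceCtorEq, not_false_eq_true, Pi.single_eq_of_ne,
      neg_zero] at hL1 hL2 hM1 f00 f11 f01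
    obtain ⟨hL1, -⟩ := hL1
    obtain ⟨hL2, hL3⟩ := hL2
    obtain ⟨hM1, hM2⟩ := hM1
    rw [hL3, zero_mul, neg_zero, add_zero, hL2] at f00
    rw [← hL1, zero_mul, neg_zero, zero_add, hM1] at f11
    set b := γ.1 (Pi.single (Sum.inr 0) 1) (Sum.inr 0) with hb
    have hb0 : b ≠ 0 := by
      intro h
      rw [h, mul_zero] at f00
      exact hc f00.symm
    have e1 : γ.1 (Pi.single (Sum.inl 1) 1) (Sum.inl 1) = b :=
      mul_right_cancel₀ hb0 (f11.trans f00.symm)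
    -- The form makes the two unipotent coefficients equal and `M` makes them opposite, so they
    -- vanish because `2 ≠ 0`.
    have t1 : γ.1 (Pi.single (Sum.inr 1) 1) (Sum.inl 0) = 0 := by
      rw [hM2, hM1] at f01
      have : (2 * b) * γ.1 (Pi.single (Sum.inr 1) 1) (Sum.inl 0) = 0 := by
        linear_combination -f01
      exact (mul_eq_zero.1 this).resolve_left (mul_ne_zero h2 hb0)
    have t0 : γ.1 (Pi.single (Sum.inr 0) 1) (Sum.inl 1) = 0 := by
      rw [hM2, t1, neg_zero]
    refine mem_scalars_of_fix_single hp hF hb0 fun x => funext fun y => ?_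
    rcases x with i | i <;> rcases y with j | j <;> fin_cases i <;> fin_cases j <;>
      simp [z00, z01, z10, z11, w00, w01, w10, w11, ← hL1, hL2, hL3, hM1, e1, t0, t1, ← hb]
  · rintro W (rfl | hW)
    · refine smul_eq_iff.2 fun v hv => ?_
      change _ ∈ mixedLine F
      rw [mem_mixedLine, torusElement_inl, torusElement_inr, torusElement_inr, hv.1, hv.2]
      simp
    · exact torusElement_smul _ W hW
  · have := congrArg Units.val h
    simp at this
    linear_combination this
  · rintro W (rfl | ⟨_, hJ, hk, ⟨j, rfl⟩, rfl⟩)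
    · refine smul_eq_iff.2 fun v hv => ?_
      change _ ∈ mixedLine F
      rw [mem_mixedLine, siegelElement_inl, siegelElement_inr, siegelElement_inr, hv.1, hv.2]
      simp
    · refine smul_eq_iff.2 fun v hv => siegelElement_fix ?_ v hv
      fin_cases j <;> simp [s]

end SmallFields

/-! ### Transvections over `𝔽₂` and the IBIS property for actions on vectors -/

section FieldTwo

variable {F : Type*} [Field F] {m : ℕ}

theorem map_smul_of_card_eq_two (hF : Nat.card F = 2) (γ : GammaSp F m) (a : F) (v : Space F m) :
    γ.1 (a • v) = a • γ.1 v := by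
  obtain ⟨-, σ, c, hc, hs, -⟩ := γ.2
  rw [hs, ringEquiv_apply_of_card_prime Nat.prime_two hF]

/-- Over `𝔽₂` the vectors fixed by a semisimilarity form a subspace. -/
def fixedSubspace (hF : Nat.card F = 2) (γ : GammaSp F m) : Submodule F (Space F m) where
  carrier := {v | γ.1 v = v}
  zero_mem' := map_zero' γ
  add_mem' {u v} hu hv := by
    rw [Set.mem_ofPred_eq] at hu hv ⊢
    rw [γ.2.1, hu, hv]
  smul_mem' a v hv := by
    rw [Set.mem_ofPred_eq] at hv ⊢
    rw [map_smul_of_card_eq_two hF, hv]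

theorem mem_fixedSubspace {hF : Nat.card F = 2} {γ : GammaSp F m} {v : Space F m} :
    v ∈ fixedSubspace hF γ ↔ γ.1 v = v := Iff.rfl

theorem exists_form_eq_one {a : Space F m} (ha : a ≠ 0) : ∃ v, form a v = 1 := by
  by_contra! h
  refine ha (eq_zero_of_form_eq_zero fun v => ?_)
  by_contra hv
  exact h ((form a v)⁻¹ • v) (by rw [form_smul_right, inv_mul_cancel₀ hv])

theorem add_self_of_card_eq_two (hF : Nat.card F = 2) (a : F) : a + a = 0 := by
  by_cases ha : a = 0
  · rw [ha, add_zero]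
  · rw [eq_one_of_card_eq_two hF ha]
    by_contra h
    have := eq_one_of_card_eq_two hF h
    rw [add_eq_left] at this
    exact one_ne_zero this

/-- If `a`, `b` are not orthogonal, the transvection along `a + b` sends `a` to `b`. In general,
pass through a vector orthogonal to neither; one exists because two proper subspaces do not cover
the space. -/
theorem exists_map_eq_of_card_eq_two (hF : Nat.card F = 2) {a b : Space F m} (ha : a ≠ 0)
    (hb : b ≠ 0) : ∃ γ : GammaSp F m, γ.1 a = b := by
  have adj : ∀ a b : Space F m, form a b ≠ 0 → (transvection (a + b)).1 a = b := by
    intro a b h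
    rw [transvection_apply, form_add_right, form_self, zero_add, eq_one_of_card_eq_two hF h,
      one_smul, ← add_assoc]
    funext x
    simp [add_self_of_card_eq_two hF]
  obtain ⟨c, hac, hbc⟩ : ∃ c, form a c ≠ 0 ∧ form b c ≠ 0 := by
    obtain ⟨c, hc⟩ := exists_form_eq_one ha
    obtain ⟨d, hd⟩ := exists_form_eq_one hb
    by_cases h1 : form b c = 0
    · by_cases h2 : form a d = 0
      · exact ⟨c + d, by simp [form_add_right, h2, hc], by simp [form_add_right, h1, hd]⟩
      · exact ⟨d, h2, by simp [hd]⟩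
    · exact ⟨c, by simp [hc], h1⟩
  have hcb : form c b ≠ 0 := by
    rw [form_swap]
    exact neg_ne_zero.2 hbc
  refine ⟨transvection (c + b) * transvection (a + c), ?_⟩
  change (transvection (c + b)).1 ((transvection (a + c)).1 a) = b
  rw [adj a c hac, adj c b hcb]

theorem conj_transvection (hF : Nat.card F = 2) (γ : GammaSp F m) (a : Space F m) :
    γ * transvection a * γ⁻¹ = transvection (γ.1 a) := by
  rw [mul_inv_eq_iff_eq_mul]
  refine Subtype.ext (Equiv.ext fun v => ?_)
  change γ.1 ((transvection a).1 v) = (transvection (γ.1 a)).1 (γ.1 v)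
  rw [transvection_apply, transvection_apply, γ.2.1, map_smul_of_card_eq_two hF,
    form_map_of_card_eq_two hF]

open scoped commutatorElement in
-- All transvections are conjugate, and a quotient of conjugate elements is a commutator.
theorem transvection_mul_inv_mem_commutator (hF : Nat.card F = 2) {a b : Space F m} (ha : a ≠ 0)
    (hb : b ≠ 0) : transvection a * (transvection b)⁻¹ ∈ commutator (GammaSp F m) := by
  obtain ⟨γ, rfl⟩ := exists_map_eq_of_card_eq_two hF ha hb
  have : transvection a * (transvection (γ.1 a))⁻¹ = ⁅transvection a, γ⁆ := by
    rw [← conj_transvection hF, commutatorElement_def]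
    group
  rw [this]
  exact Subgroup.commutator_mem_commutator (Subgroup.mem_top _) (Subgroup.mem_top _)

theorem transvection_injective {a b : Space F m} (hF : Nat.card F = 2) (ha : a ≠ 0)
    (h : transvection a = transvection b) : a = b := by
  obtain ⟨v, hv⟩ := exists_form_eq_one ha
  have hv' : form v a ≠ 0 := by
    rw [form_swap, hv]
    exact neg_ne_zero.2 one_ne_zero
  have h1 : (transvection a).1 v = (transvection b).1 v := by rw [h]
  rw [transvection_apply, transvection_apply, add_right_inj, eq_one_of_card_eq_two hF hv',
    one_smul] at h1
  by_cases h0 : form v b = 0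
  · rw [h0, zero_smul] at h1
    exact absurd h1 ha
  · rwa [eq_one_of_card_eq_two hF h0, one_smul] at h1

/-- Each `γ v - v` is orthogonal to `U`, hence is `0` or `a`. Comparing with a moved vector shows
that fixed vectors are orthogonal to `a`. Were some moved vector `u` also orthogonal to `a`, then,
since `v + u` is fixed whenever `v` is moved, `a` would be orthogonal to everything. -/
theorem eq_transvection_of_fix (hF : Nat.card F = 2) {γ : GammaSp F m} (hγ : γ ≠ 1)
    {U : Submodule F (Space F m)} (hU : ∀ u ∈ U, γ.1 u = u) {a : Space F m}
    (ha : (bilinForm F m).orthogonal U = F ∙ a) : γ = transvection a := by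
  have hmem : ∀ v, γ.1 v - v ∈ F ∙ a := by
    intro v
    rw [← ha, LinearMap.BilinForm.mem_orthogonal_iff]
    intro u hu
    change form u (γ.1 v - v) = 0
    have h1 := form_map_of_card_eq_two hF γ u v
    rw [hU u hu] at h1
    rw [sub_eq_add_neg, ← neg_one_smul F v, form_add_right, form_smul_right, h1]
    ring
  have hdich : ∀ v, γ.1 v = v ∨ γ.1 v = v + a := by
    intro v
    obtain ⟨t, ht⟩ := Submodule.mem_span_singleton.1 (hmem v)
    by_cases h0 : t = 0
    · rw [h0, zero_smul] at ht
      exact Or.inl (sub_eq_zero.1 ht.symm)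
    · rw [eq_one_of_card_eq_two hF h0, one_smul] at ht
      exact Or.inr (by rw [ht, add_sub_cancel])
  obtain ⟨w, hw⟩ : ∃ w, γ.1 w ≠ w := by
    by_contra! h
    exact hγ (Subtype.ext (Equiv.ext h))
  have hwa := (hdich w).resolve_left hw
  have hfix : ∀ u, γ.1 u = u → form u a = 0 := by
    intro u hu
    have h1 := form_map_of_card_eq_two hF γ u w
    rwa [hu, hwa, form_add_right, add_eq_left] at h1
  have ha0 : a ≠ 0 := by
    rintro rfl
    exact hw (by rw [hwa, add_zero])
  have hmove : ∀ u, γ.1 u = u + a → form u a ≠ 0 := by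
    intro u hu h0
    have hall : ∀ v, form v a = 0 := by
      intro v
      rcases hdich v with hv | hv
      · exact hfix v hv
      · have h1 := hfix (v + u) (by
          rw [γ.2.1, hv, hu]
          funext x
          simp only [Pi.add_apply]
          linear_combination add_self_of_card_eq_two hF (a x))
        rwa [form_add_left, h0, add_zero] at h1
    refine ha0 (eq_zero_of_form_eq_zero fun v => ?_)
    rw [form_swap, hall, neg_zero]
  refine Subtype.ext (Equiv.ext fun v => ?_)
  change γ.1 v = (transvection a).1 v
  rw [transvection_apply]
  rcases hdich v with hv | hv
  · rw [hv, hfix v hv, zero_smul, add_zero]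
  · rw [hv, eq_one_of_card_eq_two hF (hmove v hv), one_smul]

section IBIS

variable {G : Type*} [Group G] {Ω : Type*} [MulAction G Ω]

variable (F) in
/-- The subspace spanned by the vectors attached to the entries of a list. -/
def listSpan (θ : Ω → Space F m) (l : List Ω) : Submodule F (Space F m) :=
  Submodule.span F (θ '' {ω | ω ∈ l})

theorem fix_listSpan (hF : Nat.card F = 2) (ρ : G →* GammaSp F m) (θ : Ω → Space F m)
    (heq : ∀ g ω, θ (g • ω) = (ρ g).1 (θ ω)) {l : List Ω} {g : G}
    (hg : g ∈ pointwiseStabilizer G l) {u : Space F m} (hu : u ∈ listSpan F θ l) :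
    (ρ g).1 u = u := by
  rw [← mem_fixedSubspace (hF := hF)]
  refine (Submodule.span_le.2 ?_ : listSpan F θ l ≤ _) hu
  rintro _ ⟨ω, hω, rfl⟩
  rw [SetLike.mem_coe, mem_fixedSubspace, ← heq, mem_pointwiseStabilizer.1 hg ω hω]

theorem mem_pointwiseStabilizer_of_fix (ρ : G →* GammaSp F m) {θ : Ω → Space F m}
    (hθ : Function.Injective θ) (heq : ∀ g ω, θ (g • ω) = (ρ g).1 (θ ω)) {l : List Ω} {g : G}
    (h : ∀ u ∈ listSpan F θ l, (ρ g).1 u = u) : g ∈ pointwiseStabilizer G l :=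
  mem_pointwiseStabilizer.2 fun ω hω => hθ <| by
    rw [heq, h _ (Submodule.subset_span ⟨ω, hω, rfl⟩)]

/-- A vector already in the span of its predecessors is fixed by their stabilizer, so it would be
redundant. Each entry therefore raises the dimension by one. -/
theorem finrank_listSpan (hF : Nat.card F = 2) (ρ : G →* GammaSp F m) {θ : Ω → Space F m}
    (hθ : Function.Injective θ) (heq : ∀ g ω, θ (g • ω) = (ρ g).1 (θ ω)) (l : List Ω)
    (hl : IsIrredundant G l) : Module.finrank F (listSpan F θ l) = l.length := by
  induction l using List.reverseRecOn with
  | nil =>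
    have h : {ω : Ω | ω ∈ []} = ∅ := by
      ext
      simp
    rw [listSpan, h, Set.image_empty, Submodule.span_empty, finrank_bot, List.length_nil]
  | append_singleton l ω ih =>
    rw [isIrredundant_append_singleton] at hl
    have hnot : θ ω ∉ listSpan F θ l := by
      intro hmem
      refine hl.2.not_ge fun g hg => ?_
      rw [pointwiseStabilizer_append_singleton]
      refine ⟨hg, MulAction.mem_stabilizer_iff.2 (hθ ?_)⟩
      rw [heq, fix_listSpan hF ρ θ heq hg hmem]
    have hset : listSpan F θ (l ++ [ω]) = listSpan F θ l ⊔ F ∙ θ ω := by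
      rw [listSpan, listSpan, ← Submodule.span_union, ← Set.image_singleton, ← Set.image_union]
      congr 2
      ext x
      simp [or_comm]
    have h0 : θ ω ≠ 0 := fun h => hnot (h ▸ Submodule.zero_mem _)
    have hdis : listSpan F θ l ⊓ (F ∙ θ ω) = ⊥ := disjoint_iff.1
      ((Submodule.disjoint_span_singleton' h0).2 hnot)
    have := Submodule.finrank_sup_add_finrank_inf_eq (listSpan F θ l) (F ∙ θ ω)
    rw [hdis, finrank_bot, add_zero, ← hset, ih hl.1, finrank_span_singleton h0] at this
    rw [this]
    simp

theorem transvection_fix_of_mem_orthogonal {U : Submodule F (Space F m)} {a : Space F m}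
    (ha : a ∈ (bilinForm F m).orthogonal U) {u : Space F m} (hu : u ∈ U) :
    (transvection a).1 u = u := by
  rw [transvection_apply, show form u a = 0 from ha u hu, zero_smul, add_zero]

theorem finrank_orthogonal_listSpan (U : Submodule F (Space F m)) :
    Module.finrank F ((bilinForm F m).orthogonal U) + Module.finrank F U = 2 * m := by
  have h1 := LinearMap.BilinForm.finrank_orthogonal (bilinForm_nondegenerate (F := F) (m := m)) U
  have h2 := U.finrank_le
  have h3 : Module.finrank F (Space F m) = 2 * m := by
    rw [Module.finrank_fintype_fun_eq_card, Fintype.card_sum, Fintype.card_fin, two_mul]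
  omega

/-- The range contains all quotients of transvections, hence all transvections or none. The length
of an irredundant base is the dimension of its span, found by asking which transvections, or
quotients of two, fix the span pointwise. -/
theorem isIBIS_of_card_eq_two (hF : Nat.card F = 2) (ρ : G →* GammaSp F m)
    (hρ : Function.Injective ρ) (hcomm : commutator (GammaSp F m) ≤ ρ.range) (θ : Ω → Space F m)
    (hθ : Function.Injective θ) (heq : ∀ g ω, θ (g • ω) = (ρ g).1 (θ ω)) : IsIBIS G Ω := by
  suffices h : ∃ N, ∀ l : List Ω, IsIrredundantBase G l → l.length = N by
    obtain ⟨N, hN⟩ := h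
    exact fun l l' hl hl' => (hN l hl).trans (hN l' hl').symm
  have triv : ∀ l : List Ω, IsBase G l → ∀ γ ∈ ρ.range,
      (∀ u ∈ listSpan F θ l, γ.1 u = u) → γ = 1 := by
    rintro l hl _ ⟨g, rfl⟩ h
    have hg := mem_pointwiseStabilizer_of_fix ρ hθ heq h
    rw [hl, Subgroup.mem_bot] at hg
    rw [hg, map_one]
  by_cases hall : ∀ a : Space F m, a ≠ 0 → transvection a ∈ ρ.range
  · refine ⟨2 * m, fun l hl => ?_⟩
    rw [← finrank_listSpan hF ρ hθ heq l hl.2, ← finrank_orthogonal_listSpan (listSpan F θ l)]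
    suffices h : (bilinForm F m).orthogonal (listSpan F θ l) = ⊥ by
      rw [h, finrank_bot, zero_add]
    rw [Submodule.eq_bot_iff]
    intro a ha
    by_contra ha0
    have := triv l hl.1 _ (hall a ha0) fun u hu => transvection_fix_of_mem_orthogonal ha hu
    exact transvection_notMem_scalars ha0 (this ▸ Subgroup.one_mem _)
  · push Not at hall
    obtain ⟨b, hb0, hb⟩ := hall
    have hnone : ∀ a : Space F m, a ≠ 0 → transvection a ∉ ρ.range := fun a ha0 ha =>
      hb <| by
        simpa using Subgroup.mul_mem _
          (hcomm (transvection_mul_inv_mem_commutator hF hb0 ha0)) ha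
    refine ⟨2 * m - 1, fun l hl => ?_⟩
    have hlen := finrank_listSpan hF ρ hθ heq l hl.2
    have hdim := finrank_orthogonal_listSpan (listSpan F θ l)
    -- Two independent vectors orthogonal to the span would give a nontrivial quotient of
    -- transvections in the stabilizer.
    have hle : Module.finrank F ((bilinForm F m).orthogonal (listSpan F θ l)) ≤ 1 := by
      by_contra hgt
      obtain ⟨a, ha, ha0⟩ := Submodule.exists_mem_ne_zero_of_ne_bot
        (p := (bilinForm F m).orthogonal (listSpan F θ l)) (by
          intro h
          rw [h, finrank_bot] at hgt
          omega)
      obtain ⟨c, hc, hca⟩ : ∃ c ∈ (bilinForm F m).orthogonal (listSpan F θ l), c ∉ F ∙ a := by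
        by_contra! h
        have := Submodule.finrank_mono
          (show (bilinForm F m).orthogonal (listSpan F θ l) ≤ F ∙ a from h)
        rw [finrank_span_singleton ha0] at this
        omega
      have hc0 : c ≠ 0 := fun h => hca (h ▸ Submodule.zero_mem _)
      have := triv l hl.1 _ (hcomm (transvection_mul_inv_mem_commutator hF ha0 hc0)) (by
        intro u hu
        have h1 : (transvection c)⁻¹.1 u = u := by
          change (transvection c).1.symm u = u
          rw [Equiv.symm_apply_eq]
          exact (transvection_fix_of_mem_orthogonal hc hu).symm
        change (transvection a).1 ((transvection c)⁻¹.1 u) = u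
        rw [h1, transvection_fix_of_mem_orthogonal ha hu])
      have hac := transvection_injective hF ha0 (mul_inv_eq_one.1 this)
      exact hca (hac ▸ Submodule.mem_span_singleton_self a)
    -- If the base spanned everything, its entries but the last would span a hyperplane. Their
    -- nontrivial stabilizer would then contain a transvection, and the range has none.
    have hne : Module.finrank F ((bilinForm F m).orthogonal (listSpan F θ l)) ≠ 0 := by
      intro h0
      have hm : 0 < m := by
        rcases Nat.eq_zero_or_pos m with rfl | h
        · exact absurd (Subsingleton.elim b 0) hb0
        · exact h
      rcases List.eq_nil_or_concat' l with rfl | ⟨t, ω, rfl⟩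
      · rw [List.length_nil] at hlen
        omega
      obtain ⟨ht, hlt⟩ := isIrredundant_append_singleton.1 hl.2
      have htlen := finrank_listSpan hF ρ hθ heq t ht
      have htdim := finrank_orthogonal_listSpan (listSpan F θ t)
      rw [List.length_append, List.length_singleton] at hlen
      obtain ⟨⟨a, ha⟩, ha0, hspan⟩ := finrank_eq_one_iff'.1
        (show Module.finrank F ((bilinForm F m).orthogonal (listSpan F θ t)) = 1 by omega)
      obtain ⟨g, hg, hgt⟩ := SetLike.exists_of_lt hlt
      have hg1 : g ≠ 1 := by
        rintro rfl
        exact hgt (Subgroup.one_mem _)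
      refine hnone a (fun h => ha0 (Subtype.ext h)) ⟨g, eq_transvection_of_fix hF
        (fun h => hg1 (hρ (h.trans (map_one ρ).symm)))
        (fun u hu => fix_listSpan hF ρ θ heq hg hu) (le_antisymm ?_ ?_)⟩
      · intro v hv
        obtain ⟨c, hc⟩ := hspan ⟨v, hv⟩
        exact Submodule.mem_span_singleton.2 ⟨c, congrArg Subtype.val hc⟩
      · exact (Submodule.span_singleton_le_iff_mem _ _).2 ha
    omega

end IBIS

end FieldTwo

end Sympl

/-! ### Points and lines over `𝔽₂` -/

namespace Sympl

section FieldTwo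

variable {F : Type*} [Field F] {m k : ℕ}

theorem eq_one_of_mem_scalars (hF : Nat.card F = 2) {γ : GammaSp F m} (h : γ ∈ scalars F m) :
    γ = 1 := by
  obtain ⟨a, ha, hs⟩ := h
  refine Subtype.ext (Equiv.ext fun v => ?_)
  rw [hs, eq_one_of_card_eq_two hF ha, one_smul]
  rfl

/-- Over `𝔽₂` the projective group is the group of semisimilarities itself. -/
def fromProjective (hF : Nat.card F = 2) : PGammaSp F m →* GammaSp F m :=
  QuotientGroup.lift (scalars F m) (MonoidHom.id _) fun _ h => eq_one_of_mem_scalars hF h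

theorem fromProjective_mk (hF : Nat.card F = 2) (γ : GammaSp F m) :
    fromProjective hF (QuotientGroup.mk γ) = γ := rfl

theorem fromProjective_injective (hF : Nat.card F = 2) :
    Function.Injective (fromProjective (m := m) hF) := by
  intro x y h
  obtain ⟨x, rfl⟩ := QuotientGroup.mk_surjective x
  obtain ⟨y, rfl⟩ := QuotientGroup.mk_surjective y
  rw [fromProjective_mk, fromProjective_mk] at h
  rw [h]

theorem PSp_eq_top (hF : Nat.card F = 2) : PSp F m = ⊤ := by
  have : Sp F m = ⊤ := eq_top_iff.2 fun γ _ =>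
    ⟨map_smul_of_card_eq_two hF γ, form_map_of_card_eq_two hF γ⟩
  rw [PSp, this]
  exact Subgroup.map_top_of_surjective _ (QuotientGroup.mk'_surjective _)

/-- In both cases of its definition, `simpleGroup` contains the derived subgroup of `PSp`, which
over `𝔽₂` is the whole projective group. -/
theorem commutator_le_range (hF : Nat.card F = 2) (G : Subgroup (PGammaSp F m))
    (hG : simpleGroup F m ≤ G) :
    commutator (GammaSp F m) ≤ ((fromProjective hF).comp G.subtype).range := by
  intro γ hγ
  have h1 : (QuotientGroup.mk' (scalars F m)) γ ∈ ⁅PSp F m, PSp F m⁆ := by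
    have := Subgroup.mem_map_of_mem (QuotientGroup.mk' (scalars F m)) hγ
    rwa [commutator_def, Subgroup.map_commutator,
      Subgroup.map_top_of_surjective _ (QuotientGroup.mk'_surjective _),
      ← PSp_eq_top hF] at this
  have h2 : ⁅PSp F m, PSp F m⁆ ≤ simpleGroup F m := by
    rw [simpleGroup]
    split_ifs
    · exact le_rfl
    · rw [PSp_eq_top hF]
      exact le_top
  exact ⟨⟨_, hG (h2 h1)⟩, rfl⟩

theorem isIBIS_points (hF : Nat.card F = 2) (G : Subgroup (PGammaSp F m))
    (hG : simpleGroup F m ≤ G) : IsIBIS G (TotallySingular F m 1) := by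
  have key : ∀ W : TotallySingular F m 1, ∃ v, v ≠ 0 ∧ v ∈ W.1 ∧ ∀ w ∈ W.1, w ≠ 0 → w = v := by
    intro W
    obtain ⟨v, hv, hs⟩ := finrank_eq_one_iff'.1 W.2.1
    refine ⟨v.1, fun h => hv (Subtype.ext h), v.2, fun w hw hw0 => ?_⟩
    obtain ⟨c, hc⟩ := hs ⟨w, hw⟩
    have hcw : c • v.1 = w := congrArg Subtype.val hc
    have hc0 : c ≠ 0 := by
      rintro rfl
      exact hw0 (by rw [← hcw, zero_smul])
    rw [← hcw, eq_one_of_card_eq_two hF hc0, one_smul]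
  choose θ hθ0 hθ hθu using key
  refine isIBIS_of_card_eq_two hF ((fromProjective hF).comp G.subtype)
    ((fromProjective_injective hF).comp Subtype.val_injective) (commutator_le_range hF G hG) θ ?_ ?_
  · intro W W' h
    apply Subtype.ext
    ext w
    by_cases hw : w = 0
    · simp [hw]
    · constructor
      · intro h'
        rw [hθu W w h' hw, h]
        exact hθ W'
      · intro h'
        rw [hθu W' w h' hw, ← h]
        exact hθ W
  · rintro ⟨g, hg⟩ W
    obtain ⟨γ, rfl⟩ := QuotientGroup.mk_surjective g
    refine (hθu (γ • W) (γ.1 (θ W)) ⟨_, hθ W, rfl⟩ fun h => hθ0 W ?_).symm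
    exact γ.1.injective (h.trans (map_zero' γ).symm)

/-! ### The duality between points and lines of the symplectic quadrangle of order two -/

/-- Four of the six Plücker coordinates of the line spanned by `a` and `b`. -/
def plucker (a b : Space F 2) : Space F 2 :=
  Sum.elim ![a (Sum.inl 0) * b (Sum.inl 1) - a (Sum.inl 1) * b (Sum.inl 0),
      a (Sum.inl 0) * b (Sum.inr 1) - a (Sum.inr 1) * b (Sum.inl 0)]
    ![a (Sum.inr 0) * b (Sum.inr 1) - a (Sum.inr 1) * b (Sum.inr 0),
      a (Sum.inl 1) * b (Sum.inr 0) - a (Sum.inr 0) * b (Sum.inl 1)]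

theorem plucker_combination (s t s' t' : F) (a b : Space F 2) :
    plucker (s • a + t • b) (s' • a + t' • b) = (s * t' - t * s') • plucker a b := by
  funext x
  rcases x with i | i <;> fin_cases i <;> simp [plucker] <;> ring

theorem two_eq_zero (hF : Nat.card F = 2) : (2 : F) = 0 := by
  rw [← one_add_one_eq_two, add_self_of_card_eq_two hF]

theorem mul_self_of_card_eq_two (hF : Nat.card F = 2) (a : F) : a * a = a := by
  by_cases ha : a = 0
  · rw [ha, zero_mul]
  · rw [eq_one_of_card_eq_two hF ha, one_mul]

/-- In characteristic two both sides are the determinant of `a, b, a', b'`: the left by Laplace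
expansion, where the two omitted coordinates contribute an even term, the right as the Pfaffian of
the Gram matrix. -/
theorem form_plucker (hF : Nat.card F = 2) {a b a' b' : Space F 2} (h : form a b = 0)
    (h' : form a' b' = 0) :
    form (plucker a b) (plucker a' b') = form a a' * form b b' - form a b' * form b a' := by
  have h2 := two_eq_zero hF
  simp only [form, plucker, Fin.sum_univ_two, Sum.elim_inl, Sum.elim_inr, Matrix.cons_val_zero,
    Matrix.cons_val_one] at h h' ⊢
  linear_combination -h2 * ((a (Sum.inr 0) * b (Sum.inr 1) - a (Sum.inr 1) * b (Sum.inr 0)) *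
      (a' (Sum.inl 0) * b' (Sum.inl 1) - a' (Sum.inl 1) * b' (Sum.inl 0)) +
    (a (Sum.inl 1) * b (Sum.inr 0) - a (Sum.inr 0) * b (Sum.inl 1)) *
      (a' (Sum.inl 0) * b' (Sum.inr 1) - a' (Sum.inr 1) * b' (Sum.inl 0)) +
    (a (Sum.inl 0) * b (Sum.inr 0) - a (Sum.inr 0) * b (Sum.inl 0)) *
      (a' (Sum.inl 0) * b' (Sum.inr 0) - a' (Sum.inr 0) * b' (Sum.inl 0))) -
    h * (a' (Sum.inl 1) * b' (Sum.inr 1) - a' (Sum.inr 1) * b' (Sum.inl 1)) +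
    h' * (a (Sum.inl 0) * b (Sum.inr 0) - a (Sum.inr 0) * b (Sum.inl 0))

theorem exists_plucker_eq (hF : Nat.card F = 2) {p : Space F 2} (hp : p ≠ 0) :
    ∃ a b, form a b = 0 ∧ plucker a b = p := by
  have h2 := two_eq_zero hF
  have hsq := mul_self_of_card_eq_two hF
  by_cases hx : p (Sum.inl 0) = 0
  · by_cases hy : p (Sum.inl 1) = 0
    · by_cases hz : p (Sum.inr 0) = 0
      · have hw : p (Sum.inr 1) ≠ 0 := by
          intro hw
          apply hp
          funext x
          rcases x with i | i <;> fin_cases i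
          exacts [hx, hy, hz, hw]
        refine ⟨Sum.elim ![0, 1] ![0, 0], Sum.elim ![0, 0] ![1, 0], ?_, ?_⟩
        · simp [form]
        · funext x
          rcases x with i | i <;> fin_cases i <;>
            simp [plucker, hx, hy, hz, eq_one_of_card_eq_two hF hw]
      · refine ⟨Sum.elim ![0, 0] ![1, 0], Sum.elim ![0, -p (Sum.inr 1)] ![0, 1], ?_, ?_⟩
        · simp [form]
        · funext x
          rcases x with i | i <;> fin_cases i <;>
            simp [plucker, hx, hy, eq_one_of_card_eq_two hF hz]
    · refine ⟨Sum.elim ![1, p (Sum.inr 1)] ![p (Sum.inr 0), 0],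
        Sum.elim ![0, 0] ![-p (Sum.inr 1), 1], ?_, ?_⟩
      · simp [form]
      · funext x
        rcases x with i | i <;> fin_cases i <;>
          simp [plucker, hx, eq_one_of_card_eq_two hF hy, hsq]
        linear_combination -h2 * p (Sum.inr 1)
  -- A basis in echelon form. The repeated entry is the omitted Plücker coordinate, which the
  -- quadratic Plücker relation and `x² = x` determine.
  · refine ⟨Sum.elim ![1, 0] ![-p (Sum.inr 1), p (Sum.inr 0) + p (Sum.inl 1) * p (Sum.inr 1)],
      Sum.elim ![0, 1] ![p (Sum.inr 0) + p (Sum.inl 1) * p (Sum.inr 1), p (Sum.inl 1)], ?_, ?_⟩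
    · simp [form]
    · funext x
      rcases x with i | i <;> fin_cases i <;>
        simp [plucker, eq_one_of_card_eq_two hF hx, hsq]
      linear_combination -h2 * p (Sum.inl 1) * p (Sum.inr 1) - p (Sum.inr 0) * h2

theorem exists_basis (W : TotallySingular F 2 2) :
    ∃ a b, LinearIndependent F ![a, b] ∧ W.1 = Submodule.span F {a, b} := by
  let B := Module.finBasisOfFinrankEq F W.1 W.2.1
  have hli := (LinearIndependent.map' B.linearIndependent W.1.subtype W.1.ker_subtype)
  refine ⟨B 0, B 1, ?_, ?_⟩
  · have : ![(B 0 : Space F 2), (B 1 : Space F 2)] = W.1.subtype ∘ B := by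
      funext i
      fin_cases i <;> rfl
    rw [this]
    exact hli
  · have := congrArg (Submodule.map W.1.subtype) B.span_eq
    rw [Submodule.map_span, Submodule.map_top, Submodule.range_subtype] at this
    refine this.symm.trans ?_
    congr 1
    ext v
    simp [eq_comm, Fin.exists_fin_two]

/-- The vector corresponding to a line under the duality. -/
noncomputable def dualPoint (W : TotallySingular F 2 2) : Space F 2 :=
  plucker (exists_basis W).choose (exists_basis W).choose_spec.choose

theorem dualPoint_spec (W : TotallySingular F 2 2) :
    ∃ a b, LinearIndependent F ![a, b] ∧ W.1 = Submodule.span F {a, b} ∧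
      dualPoint W = plucker a b :=
  ⟨_, _, (exists_basis W).choose_spec.choose_spec.1, (exists_basis W).choose_spec.choose_spec.2,
    rfl⟩

/-- The line `W` meets the orthogonal complement of `W'`, which is `W'` itself. -/
def Meets (W W' : TotallySingular F 2 2) : Prop :=
  ∃ u ∈ W.1, u ≠ 0 ∧ ∀ v ∈ W'.1, form u v = 0

theorem meets_smul_iff (γ : GammaSp F 2) (W W' : TotallySingular F 2 2) :
    Meets (γ • W) (γ • W') ↔ Meets W W' := by
  obtain ⟨-, σ, c, hc, -, hf⟩ := γ.2
  constructor
  · rintro ⟨_, ⟨u, hu, rfl⟩, hu0, h⟩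
    refine ⟨u, hu, ?_, fun v hv => ?_⟩
    · rintro rfl
      exact hu0 (map_zero' γ)
    · have := h (γ.1 v) ⟨v, hv, rfl⟩
      rw [hf] at this
      simpa [hc] using this
  · rintro ⟨u, hu, hu0, h⟩
    refine ⟨γ.1 u, ⟨u, hu, rfl⟩, fun h0 => hu0 ?_, ?_⟩
    · exact γ.1.injective (h0.trans (map_zero' γ).symm)
    · rintro _ ⟨v, hv, rfl⟩
      rw [hf, h v hv, map_zero, mul_zero]

/-- By `form_plucker` the left side is the determinant of the matrix of pairings between bases of
`W` and `W'`; a kernel vector of this matrix is a vector of `W` orthogonal to `W'`. -/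
theorem form_dualPoint_eq_zero_iff (hF : Nat.card F = 2) (W W' : TotallySingular F 2 2) :
    form (dualPoint W) (dualPoint W') = 0 ↔ Meets W W' := by
  obtain ⟨a, b, hli, hW, hp⟩ := dualPoint_spec W
  obtain ⟨a', b', hli', hW', hp'⟩ := dualPoint_spec W'
  have ha : a ∈ W.1 := hW ▸ Submodule.subset_span (by simp)
  have hb : b ∈ W.1 := hW ▸ Submodule.subset_span (by simp)
  have ha' : a' ∈ W'.1 := hW' ▸ Submodule.subset_span (by simp)
  have hb' : b' ∈ W'.1 := hW' ▸ Submodule.subset_span (by simp)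
  rw [LinearIndependent.pair_iff] at hli
  rw [hp, hp', form_plucker hF (W.2.2 a ha b hb) (W'.2.2 a' ha' b' hb')]
  constructor
  · intro h
    have key : ∀ s t : F, ¬(s = 0 ∧ t = 0) → s * form a a' + t * form b a' = 0 →
        s * form a b' + t * form b b' = 0 → Meets W W' := by
      intro s t hst h1 h2
      refine ⟨s • a + t • b, W.1.add_mem (W.1.smul_mem _ ha) (W.1.smul_mem _ hb),
        fun h0 => hst (hli s t h0), fun v hv => ?_⟩
      rw [hW'] at hv
      obtain ⟨x, y, rfl⟩ := Submodule.mem_span_pair.1 hv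
      simp only [form_add_left, form_smul_left, form_add_right, form_smul_right]
      linear_combination x * h1 + y * h2
    by_cases h1 : form b a' = 0 ∧ form a a' = 0
    · by_cases h2 : form b b' = 0 ∧ form a b' = 0
      · exact key 1 0 (by simp) (by simp [h1]) (by simp [h2])
      · exact key (form b b') (-form a b') (by simpa using h2) (by simp [h1]) (by ring)
    · exact key (form b a') (-form a a') (by simpa using h1) (by ring) (by linear_combination -h)
  · rintro ⟨u, hu, hu0, hv⟩
    rw [hW] at hu
    obtain ⟨s, t, rfl⟩ := Submodule.mem_span_pair.1 hu
    have h1 := hv a' ha'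
    have h2 := hv b' hb'
    simp only [form_add_left, form_smul_left] at h1 h2
    by_cases hs : s = 0
    · have ht : t ≠ 0 := by
        rintro rfl
        exact hu0 (by simp [hs])
      apply mul_left_cancel₀ ht
      linear_combination form a a' * h2 - form a b' * h1
    · apply mul_left_cancel₀ hs
      linear_combination form b b' * h1 - form b a' * h2

theorem dualPoint_eq (hF : Nat.card F = 2) {W : TotallySingular F 2 2} {a b : Space F 2}
    (ha : a ∈ W.1) (hb : b ∈ W.1) (h : plucker a b ≠ 0) : dualPoint W = plucker a b := by
  obtain ⟨a', b', -, hW, hp⟩ := dualPoint_spec W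
  rw [hW] at ha hb
  obtain ⟨s, t, rfl⟩ := Submodule.mem_span_pair.1 ha
  obtain ⟨s', t', rfl⟩ := Submodule.mem_span_pair.1 hb
  rw [plucker_combination] at h ⊢
  have hne : s * t' - t * s' ≠ 0 := fun h0 => h (by rw [h0, zero_smul])
  rw [eq_one_of_card_eq_two hF hne, one_smul, hp]

/-- Total singularity makes the two omitted minors opposite, so the Plücker relation gives the
square of this one, and squaring is the identity on `𝔽₂`. -/
theorem minor_eq_plucker (hF : Nat.card F = 2) {a b : Space F 2} (h : form a b = 0) :
    a (Sum.inl 0) * b (Sum.inr 0) - a (Sum.inr 0) * b (Sum.inl 0) =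
      -(plucker a b (Sum.inl 0) * plucker a b (Sum.inr 0) +
        plucker a b (Sum.inl 1) * plucker a b (Sum.inr 1)) := by
  rw [← mul_self_of_card_eq_two hF (a (Sum.inl 0) * b (Sum.inr 0) - _)]
  simp only [form, plucker, Fin.sum_univ_two, Sum.elim_inl, Sum.elim_inr, Matrix.cons_val_zero,
    Matrix.cons_val_one] at h ⊢
  linear_combination (a (Sum.inl 0) * b (Sum.inr 0) - a (Sum.inr 0) * b (Sum.inl 0)) * h

theorem minor_eq_of_plucker_eq (hF : Nat.card F = 2) {a b a' b' : Space F 2} (h : form a b = 0)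
    (h' : form a' b' = 0) (hp : plucker a b = plucker a' b') (x y : Fin 2 ⊕ Fin 2) :
    a x * b y - a y * b x = a' x * b' y - a' y * b' x := by
  have h13 := minor_eq_plucker hF h
  rw [hp, ← minor_eq_plucker hF h'] at h13
  have h12 := congrFun hp (Sum.inl 0)
  have h14 := congrFun hp (Sum.inl 1)
  have h34 := congrFun hp (Sum.inr 0)
  have h23 := congrFun hp (Sum.inr 1)
  simp only [form, plucker, Fin.sum_univ_two, Sum.elim_inl, Sum.elim_inr, Matrix.cons_val_zero,
    Matrix.cons_val_one] at h h' h12 h14 h34 h23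
  have h24 : a (Sum.inl 1) * b (Sum.inr 1) - a (Sum.inr 1) * b (Sum.inl 1) =
      a' (Sum.inl 1) * b' (Sum.inr 1) - a' (Sum.inr 1) * b' (Sum.inl 1) := by
    linear_combination h - h' - h13
  rcases x with i | i <;> rcases y with j | j <;> fin_cases i <;> fin_cases j <;>
    simp only [Fin.zero_eta, Fin.mk_one, Fin.isValue]
  exacts [by ring, h12, by linear_combination -h12, by ring, h13, h14, h23, h24,
    by linear_combination -h13, by linear_combination -h23, by linear_combination -h14,
    by linear_combination -h24, by ring, h34, by linear_combination -h34, by ring]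

theorem exists_minor_ne_zero {a b : Space F m} (hli : LinearIndependent F ![a, b]) :
    ∃ x y, a x * b y - a y * b x ≠ 0 := by
  by_contra! h
  rw [LinearIndependent.pair_iff] at hli
  have key : ∀ x, a x = 0 := fun x => by
    have := hli (b x) (-a x) (funext fun y => by
      simp only [Pi.add_apply, Pi.smul_apply, smul_eq_mul, Pi.zero_apply]
      linear_combination h y x)
    simpa using this.2
  have := hli 1 0 (funext fun y => by simp [key])
  simp at this

theorem plucker_ne_zero (hF : Nat.card F = 2) {a b : Space F 2}
    (hli : LinearIndependent F ![a, b]) (h : form a b = 0) : plucker a b ≠ 0 := by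
  intro h0
  obtain ⟨x, y, hxy⟩ := exists_minor_ne_zero hli
  refine hxy ((minor_eq_of_plucker_eq hF h (form_self 0) ?_ x y).trans (by simp))
  rw [h0]
  funext x
  rcases x with i | i <;> fin_cases i <;> simp [plucker]

theorem dualPoint_ne_zero (hF : Nat.card F = 2) (W : TotallySingular F 2 2) :
    dualPoint W ≠ 0 := by
  obtain ⟨a, b, hli, hW, hp⟩ := dualPoint_spec W
  rw [hp]
  exact plucker_ne_zero hF hli (W.2.2 a (hW ▸ Submodule.subset_span (by simp)) b
    (hW ▸ Submodule.subset_span (by simp)))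

theorem dualPoint_injective (hF : Nat.card F = 2) :
    Function.Injective (dualPoint : TotallySingular F 2 2 → Space F 2) := by
  intro W W' h
  obtain ⟨a, b, hli, hW, hp⟩ := dualPoint_spec W
  obtain ⟨a', b', -, hW', hp'⟩ := dualPoint_spec W'
  have ha : a ∈ W.1 := hW ▸ Submodule.subset_span (by simp)
  have hb : b ∈ W.1 := hW ▸ Submodule.subset_span (by simp)
  have ha' : a' ∈ W'.1 := hW' ▸ Submodule.subset_span (by simp)
  have hb' : b' ∈ W'.1 := hW' ▸ Submodule.subset_span (by simp)
  rw [hp, hp'] at h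
  have hm := minor_eq_of_plucker_eq hF (W.2.2 a ha b hb) (W'.2.2 a' ha' b' hb') h
  obtain ⟨x, y, hxy⟩ := exists_minor_ne_zero hli
  -- The hypothesis says that the `3 × 3` minors of `u, a', b'` involving `x` and `y` vanish. As `a,
  -- b` have the same `2 × 2` minors, Cramer's rule writes `u` in terms of `a` and `b`.
  have cramer : ∀ u : Space F 2, (∀ z, u z * (a' x * b' y - a' y * b' x) -
      u y * (a' x * b' z - a' z * b' x) + u x * (a' y * b' z - a' z * b' y) = 0) → u ∈ W.1 := by
    intro u hu
    rw [← W.1.smul_mem_iff hxy]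
    have : (a x * b y - a y * b x) • u =
        (u x * b y - u y * b x) • a + (a x * u y - a y * u x) • b := by
      funext z
      have := hu z
      rw [← hm, ← hm, ← hm] at this
      simp only [Pi.add_apply, Pi.smul_apply, smul_eq_mul]
      linear_combination this
    rw [this]
    exact W.1.add_mem (W.1.smul_mem _ ha) (W.1.smul_mem _ hb)
  refine (Subtype.ext (Submodule.eq_of_le_of_finrank_eq ?_ (W'.2.1.trans W.2.1.symm))).symm
  rw [hW', Submodule.span_le]
  rintro u (rfl | rfl)
  · exact cramer u fun z => by ring
  · exact cramer u fun z => by ring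

theorem dualPoint_surjective (hF : Nat.card F = 2) {p : Space F 2} (hp : p ≠ 0) :
    ∃ W : TotallySingular F 2 2, dualPoint W = p := by
  obtain ⟨a, b, hab, rfl⟩ := exists_plucker_eq hF hp
  have hli : LinearIndependent F ![a, b] := by
    rw [LinearIndependent.pair_iff]
    intro s t hst
    have h1 := plucker_combination s t 0 1 a b
    have h2 := plucker_combination 1 0 s t a b
    rw [hst] at h1 h2
    have z1 : ∀ v : Space F 2, plucker 0 v = 0 := fun v => by
      funext x
      rcases x with i | i <;> fin_cases i <;> simp [plucker]
    have z2 : ∀ v : Space F 2, plucker v 0 = 0 := fun v => by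
      funext x
      rcases x with i | i <;> fin_cases i <;> simp [plucker]
    rw [z1] at h1
    rw [z2] at h2
    simpa [hp] using And.intro h1.symm h2.symm
  refine ⟨⟨Submodule.span F {a, b}, ?_, fun u hu v hv => ?_⟩, dualPoint_eq hF
    (Submodule.subset_span (by simp)) (Submodule.subset_span (by simp)) hp⟩
  · have := finrank_span_eq_card hli
    rwa [Matrix.range_cons, Matrix.range_cons, Matrix.range_empty, Set.union_empty,
      Set.singleton_union, Fintype.card_fin] at this
  · obtain ⟨s, t, rfl⟩ := Submodule.mem_span_pair.1 hu
    obtain ⟨s', t', rfl⟩ := Submodule.mem_span_pair.1 hv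
    simp only [form_add_left, form_smul_left, form_add_right, form_smul_right, form_self, hab,
      form_swap a b]
    ring

/-- The duality, as a bijection from totally singular lines to nonzero vectors. -/
noncomputable def dualEquiv (hF : Nat.card F = 2) :
    TotallySingular F 2 2 ≃ {p : Space F 2 // p ≠ 0} :=
  Equiv.ofBijective (fun W => ⟨dualPoint W, dualPoint_ne_zero hF W⟩)
    ⟨fun _ _ h => dualPoint_injective hF (congrArg Subtype.val h), fun p =>
      (dualPoint_surjective hF p.2).imp fun _ h => Subtype.ext h⟩

open Classical in
/-- The permutation of the vectors induced by the action on totally singular lines. -/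
noncomputable def dualPerm (hF : Nat.card F = 2) : GammaSp F 2 →* Equiv.Perm (Space F 2) :=
  Equiv.Perm.ofSubtype.comp
    ((dualEquiv hF).permCongrHom.toMonoidHom.comp
      (MulAction.toPermHom (GammaSp F 2) (TotallySingular F 2 2)))

open Classical in
theorem dualPerm_dualPoint (hF : Nat.card F = 2) (γ : GammaSp F 2) (W : TotallySingular F 2 2) :
    dualPerm hF γ (dualPoint W) = dualPoint (γ • W) := by
  have h : dualPoint W = (dualEquiv hF W).1 := rfl
  rw [h, dualPerm, MonoidHom.comp_apply, Equiv.Perm.ofSubtype_apply_coe]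
  simp only [MonoidHom.comp_apply, MulEquiv.toMonoidHom_eq_coe, MonoidHom.coe_coe]
  change ((dualEquiv hF) (γ • (dualEquiv hF).symm (dualEquiv hF W))).1 = _
  rw [Equiv.symm_apply_apply]
  rfl

open Classical in
theorem dualPerm_zero (hF : Nat.card F = 2) (γ : GammaSp F 2) : dualPerm hF γ 0 = 0 := by
  rw [dualPerm, MonoidHom.comp_apply]
  exact Equiv.Perm.ofSubtype_apply_of_not_mem _ (by simp)

theorem form_zero_left (v : Space F m) : form 0 v = 0 := by
  rw [form_swap, form_zero_right, neg_zero]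

/-- Over `𝔽₂` a value of the form is known once it is known whether it vanishes, and vanishing means
that two lines meet, which the group preserves. -/
theorem form_dualPerm (hF : Nat.card F = 2) (γ : GammaSp F 2) (u v : Space F 2) :
    form (dualPerm hF γ u) (dualPerm hF γ v) = form u v := by
  by_cases hu : u = 0
  · rw [hu, dualPerm_zero, form_zero_left, form_zero_left]
  by_cases hv : v = 0
  · rw [hv, dualPerm_zero, form_zero_right, form_zero_right]
  obtain ⟨W, rfl⟩ := dualPoint_surjective hF hu
  obtain ⟨W', rfl⟩ := dualPoint_surjective hF hv
  rw [dualPerm_dualPoint, dualPerm_dualPoint]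
  have key : form (dualPoint (γ • W)) (dualPoint (γ • W')) = 0 ↔
      form (dualPoint W) (dualPoint W') = 0 := by
    rw [form_dualPoint_eq_zero_iff hF, form_dualPoint_eq_zero_iff hF, meets_smul_iff]
  by_cases h : form (dualPoint W) (dualPoint W') = 0
  · rw [h, key.2 h]
  · rw [eq_one_of_card_eq_two hF h, eq_one_of_card_eq_two hF fun h' => h (key.1 h')]

/-- Linearity is automatic: `T (u + v) - T u - T v` is orthogonal to every `T w`, hence to the whole
space. -/
theorem isSemisimilarity_of_form_eq (hF : Nat.card F = 2) {T : Equiv.Perm (Space F m)}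
    (hT : ∀ u v, form (T u) (T v) = form u v) : IsSemisimilarity T := by
  have h0 : T 0 = 0 := by
    refine eq_zero_of_form_eq_zero fun v => ?_
    obtain ⟨w, rfl⟩ := T.surjective v
    rw [hT, form_zero_left]
  refine ⟨fun u v => ?_, RingEquiv.refl F, 1, one_ne_zero, fun a v => ?_, fun u v => ?_⟩
  · rw [← sub_eq_zero]
    refine eq_zero_of_form_eq_zero fun w => ?_
    obtain ⟨w, rfl⟩ := T.surjective w
    rw [sub_eq_add_neg, ← neg_one_smul F (T u + T v), form_add_left, form_smul_left,
      form_add_left, hT, hT, hT, form_add_left]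
    ring
  · by_cases ha : a = 0
    · rw [ha, zero_smul, h0, map_zero, zero_smul]
    · rw [eq_one_of_card_eq_two hF ha, one_smul, map_one, one_smul]
  · rw [hT, RingEquiv.refl_apply, one_mul]

/-- The duality, as an endomorphism of the group of semisimilarities. -/
noncomputable def duality (hF : Nat.card F = 2) : GammaSp F 2 →* GammaSp F 2 :=
  (dualPerm hF).codRestrict (GammaSp F 2) fun γ =>
    isSemisimilarity_of_form_eq hF (form_dualPerm hF γ)

theorem duality_injective (hF : Nat.card F = 2) : Function.Injective (duality (F := F) hF) := by
  rw [injective_iff_map_eq_one]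
  intro γ hγ
  have hfix : ∀ W : TotallySingular F 2 2, γ • W = W := by
    intro W
    apply dualPoint_injective hF
    rw [← dualPerm_dualPoint]
    exact congrArg (fun γ : GammaSp F 2 => γ.1 (dualPoint W)) hγ
  refine eq_one_of_mem_scalars hF (mem_scalars_of_fix_single Nat.prime_two hF one_ne_zero
    fun x => ?_)
  rw [one_smul]
  exact apply_single_of_card_eq_two hF fun y hy =>
    apply_single_of_fix_all (k := 2) (by omega) le_rfl (fun W _ => hfix W) hy

theorem isIBIS_lines [Finite F] (hF : Nat.card F = 2) (G : Subgroup (PGammaSp F 2))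
    (hG : simpleGroup F 2 ≤ G) : IsIBIS G (TotallySingular F 2 2) := by
  refine isIBIS_of_card_eq_two hF ((duality hF).comp ((fromProjective hF).comp G.subtype))
    ((duality_injective hF).comp ((fromProjective_injective hF).comp Subtype.val_injective))
    ?_ dualPoint (dualPoint_injective hF) ?_
  · intro x hx
    -- An injective endomorphism of a finite group is an automorphism, so it maps the derived
    -- subgroup onto itself.
    have hsurj : Function.Surjective (duality (F := F) hF) :=
      Finite.injective_iff_surjective.1 (duality_injective hF)
    have hmap : (commutator (GammaSp F 2)).map (duality hF) = commutator (GammaSp F 2) := by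
      rw [commutator_def, Subgroup.map_commutator, Subgroup.map_top_of_surjective _ hsurj]
    rw [← hmap] at hx
    obtain ⟨y, hy, rfl⟩ := hx
    obtain ⟨g, rfl⟩ := commutator_le_range hF G hG hy
    exact ⟨g, rfl⟩
  · rintro ⟨g, hg⟩ W
    obtain ⟨γ, rfl⟩ := QuotientGroup.mk_surjective g
    exact (dualPerm_dualPoint hF γ W).symm

end FieldTwo

end Sympl

/-! ### The case division -/

theorem proposition3p16 (F : Type*) [Field F] [Finite F] (m k : ℕ) (hm : 2 ≤ m)
    (hk : 1 ≤ k) (hkm : k ≤ m)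
    (G : Subgroup (Sympl.PGammaSp F m)) (hG : Sympl.simpleGroup F m ≤ G) :
    (¬(Nat.card F = 2 ∧ k = 1) → ¬(2 * m = 4 ∧ Nat.card F = 2 ∧ k = 2) →
      ¬IsIBIS G (Sympl.TotallySingular F m k) ∧
        2 ≤ baseSize G (Sympl.TotallySingular F m k)) ∧
    ((Nat.card F = 2 ∧ k = 1) ∨ (2 * m = 4 ∧ Nat.card F = 2 ∧ k = 2) →
      IsIBIS G (Sympl.TotallySingular F m k)) := by
  refine ⟨fun h1 h2 => ?_, ?_⟩
  · have hG' : Sympl.PSp F m ≤ G := by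
      -- For `(d, q) = (4, 2)` both values of `k` are excluded here, so `simpleGroup` is `PSp`.
      rwa [Sympl.simpleGroup, if_neg (by omega)] at hG
    have hq : 1 < Nat.card F := Finite.one_lt_card
    obtain ⟨n, rfl⟩ : ∃ n, m = n + 2 := ⟨m - 2, by omega⟩
    by_cases hF2 : Nat.card F = 2
    · rcases hkm.lt_or_eq with hlt | rfl
      · exact Sympl.not_isIBIS_of_card_eq_two_of_lt hF2 (by omega) hlt G hG'
      · obtain ⟨n, rfl⟩ : ∃ j, n = j + 1 := ⟨n - 1, by omega⟩
        exact Sympl.not_isIBIS_of_card_eq_two_of_eq hF2 G hG'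
    by_cases hF3 : Nat.card F = 3 ∧ n = 0
    · obtain ⟨hF3, rfl⟩ := hF3
      have hchar : (2 : F) ≠ 0 := by
        intro h0
        have h3 : Nat.card F • (1 : F) = 0 := card_nsmul_eq_zero'
        rw [hF3, nsmul_eq_mul, mul_one] at h3
        exact one_ne_zero (show (1 : F) = 0 by
          push_cast at h3
          linear_combination h3 - h0)
      obtain rfl | rfl : k = 1 ∨ k = 2 := by omega
      · exact Sympl.not_isIBIS_points_of_card_prime Nat.prime_three hF3 hchar G hG'
      · exact Sympl.not_isIBIS_lines_of_card_prime Nat.prime_three hF3 hchar G hG'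
    · exact Sympl.not_isIBIS_of_torus hk hkm G hG' (by omega)
  · rintro (⟨hF, rfl⟩ | ⟨h4, hF, rfl⟩)
    · exact Sympl.isIBIS_points hF G hG
    · obtain rfl : m = 2 := by omega
      exact Sympl.isIBIS_lines hF G hG
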